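/- **Conventions.** Let $k$ be an algebraically closed field. All algebras are finite dimensional $k$-algebras and all modules are finitely generated right modules. For a module $X$, $|X|$ is the number of isomorphism classes of indecomposable direct summands of $X$; $X$ is basic if it has no direct summand $N\oplus N'$ with $N\cong N'$ indecomposable. Morphisms are composed as maps, so $\operatorname{Ext}^1_H(X,Y)$ is an $\operatorname{End}_H(Y)$-$\operatorname{End}_H(X)$-bimodule. An algebra is hereditary if all its right ideals are projective. An $R$-module $T$ is tilting if $\operatorname{pd}T\le 1$, $\operatorname{Ext}^1_R(T,T)=0$ and $|T|=|R|$. A tilted algebra is the endomorphism algebra of a (basic) tilting module over a hereditary algebra. Let $H$ be a hereditary algebra. A support $\tau$-tilting pair over $H$ is a pair $(T,P)$ of $H$-modules, with $P$ projective, such that $\operatorname{Hom}_H(T,\tau T)=0$, $\operatorname{Hom}_H(P,T)=0$ and $|T|+|P|=|H|$, where $\tau$ is the Auslander–Reiten translation. A 2-term silting complex is a complex $\mathbf P$ of finitely generated projective $H$-modules with non-zero terms only in degrees $-1$ and $0$ such that $\operatorname{Hom}_{\mathrm K^b(\operatorname{proj}H)}(\mathbf P,\mathbf P[i])=0$ for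 all $i>0$ and the smallest triangulated subcategory of $\mathrm K^b(\operatorname{proj}H)$ that contains $\mathbf P$ and is closed under direct summands is $\mathrm K^b(\operatorname{proj}H)$. It corresponds to $(T,P)$ if it is isomorphic in $\mathrm K^b(\operatorname{proj}H)$ to $P_1\oplus P\xrightarrow{(f,0)}P_0$ for a minimal projective presentation $P_1\xrightarrow{f}P_0\to T\to 0$. An algebra $A$ is silted with respect to a basic support $\tau$-tilting pair $(T,P)$ over $H$ (that is, with $T$ and $P$ basic) if $A\cong\operatorname{End}_{\mathcal D^b(H)}(\mathbf P)$ for some 2-term silting complex $\mathbf P$ corresponding to $(T,P)$. **Proposition 3.2.** Let $H$ be a hereditary algebra, and let $A$ be a silted algebra with respect to a basic support $\tau$-tilting pair $(T,P)$ over $H$. Put $B=\operatorname{End}_H(T)$, $H_1=\operatorname{End}_H(P)$ and let $M$ be the $H_1$-$B$-bimodule $\operatorname{Ext}^1_H(T,P)$. Then $B$ is a tilted algebra, $H_1$ is a hereditary algebra, and there is an isomorphism of $k$-algebras $$A\;\cong\;\begin{pmatrix} B & 0\\ M & H_1\end{pmatrix}.$$ Moreover, there is an idempotent $e\in H$ with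 $eH\cong P$ as $H$-modules such that $H_1\cong eHe$ as $k$-algebras, $H/HeH$ is a hereditary algebra, and $T$ is (the inflation of) a tilting module over $H/HeH$. -/

import Mathlib

open CategoryTheory

universe u v w

noncomputable section

/-!
Conventions. A right module over a ring `R` is a left module over `Rᵐᵒᵖ`, so that
`ModuleCat Rᵐᵒᵖ` is the category of right `R`-modules. In `End X` the product `f * g` is the
composite "first `g`, then `f`"; hence a right module `X` is an `End X`-`R`-bimodule in the usual
way, `Hom(X, Y)` is an `End Y`-`End X`-bimodule, and so is every `Ext^n(X, Y)`.
-/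

namespace Silted

section ModuleNotions

variable (R : Type*) [Ring R] (M : Type*) [AddCommGroup M] [Module R M]

/-- An indecomposable module: non-zero, and not a direct sum of two non-zero submodules. -/
def IsIndecomposable : Prop :=
  Nontrivial M ∧ ∀ N L : Submodule R M, IsCompl N L → N = ⊥ ∨ L = ⊥

/-- The submodules of `M` which are indecomposable direct summands of `M`. -/
def IndecSummand : Type _ :=
  {N : Submodule R M // IsIndecomposable R N ∧ ∃ L : Submodule R M, IsCompl N L}

/-- Isomorphism of indecomposable direct summands, as an equivalence relation. -/
instance indecSummandSetoid : Setoid (IndecSummand R M) where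
  r N L := Nonempty (N.1 ≃ₗ[R] L.1)
  iseqv :=
    { refl := fun N => ⟨LinearEquiv.refl R N.1⟩
      symm := fun ⟨f⟩ => ⟨f.symm⟩
      trans := fun ⟨f⟩ ⟨g⟩ => ⟨f.trans g⟩ }

/-- `|M|`, the number of pairwise non-isomorphic indecomposable direct summands of `M`. -/
def numSummands : ℕ∞ := ENat.card (Quotient (indecSummandSetoid R M))

/-- A basic module: no direct summand is the direct sum of two isomorphic indecomposable
modules. -/
def IsBasic : Prop :=
  ∀ N L C : Submodule R M, IsIndecomposable R N → IsIndecomposable R L → Disjoint N L →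
    IsCompl (N ⊔ L) C → IsEmpty (N ≃ₗ[R] L)

variable {R M} in
/-- A superfluous (small) submodule. -/
def IsSuperfluous (N : Submodule R M) : Prop :=
  ∀ L : Submodule R M, N ⊔ L = ⊤ → L = ⊤

end ModuleNotions

section Algebras

/-- A (finite dimensional) hereditary algebra: every right ideal is projective. -/
structure IsHereditaryAlgebra (k : Type v) [Field k] (R : Type u) [Ring R] [Algebra k R] :
    Prop where
  finiteDimensional : FiniteDimensional k R
  projective_rightIdeal : ∀ I : Submodule Rᵐᵒᵖ R, Module.Projective Rᵐᵒᵖ I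

/-- A tilting (right) module: finitely generated, of projective dimension at most one, without
self-extensions, and with `|T| = |R|`. -/
structure IsTilting (R : Type u) [Ring R] (T : ModuleCat.{u} Rᵐᵒᵖ) : Prop where
  finite : Module.Finite Rᵐᵒᵖ T
  projectiveDimension_le_one : HasProjectiveDimensionLE T 1
  ext_eq_zero : ∀ x : Abelian.Ext T T 1, x = 0
  numSummands_eq : numSummands Rᵐᵒᵖ T = numSummands Rᵐᵒᵖ R

/-- A tilted algebra: the endomorphism algebra of a (basic) tilting module over a finite
dimensional hereditary algebra. -/
def IsTiltedAlgebra (k : Type v) [Field k] (B : Type u) [Ring B] [Algebra k B] : Prop :=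
  ∃ (R : Type u) (_ : Ring R) (_ : Algebra k R) (T : ModuleCat.{u} Rᵐᵒᵖ),
    IsHereditaryAlgebra k R ∧ IsBasic Rᵐᵒᵖ T ∧ IsTilting R T ∧ Nonempty (B ≃ₐ[k] End T)

end Algebras

section AuslanderReiten

variable (k : Type v) [Field k] (H : Type u) [Ring H] [Algebra k H]

/-- `Q₁ --f--> Q₀ --p--> T → 0` is a minimal projective presentation of `T`: it is exact, `Q₀` and
`Q₁` are finitely generated projective, and `Q₀ → T` and `Q₁ → ker p` are projective covers. -/
structure IsMinimalProjectivePresentation {H : Type u} [Ring H] {Q₁ Q₀ T : ModuleCat.{u} Hᵐᵒᵖ}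
    (f : Q₁ ⟶ Q₀) (p : Q₀ ⟶ T) : Prop where
  finite₁ : Module.Finite Hᵐᵒᵖ Q₁
  finite₀ : Module.Finite Hᵐᵒᵖ Q₀
  projective₁ : Module.Projective Hᵐᵒᵖ Q₁
  projective₀ : Module.Projective Hᵐᵒᵖ Q₀
  exact : Function.Exact f.hom p.hom
  surjective : Function.Surjective p.hom
  minimal₀ : IsSuperfluous (LinearMap.ker p.hom)
  minimal₁ : IsSuperfluous (LinearMap.ker f.hom)

/-- The Nakayama functor on objects: `ν Q = Hom_k(Hom_H(Q, H), k)`. -/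
def Nakayama (Q : ModuleCat.{u} Hᵐᵒᵖ) : Type _ := (Q →ₗ[Hᵐᵒᵖ] H) →ₗ[k] k

instance (Q : ModuleCat.{u} Hᵐᵒᵖ) : AddCommGroup (Nakayama k H Q) :=
  inferInstanceAs (AddCommGroup ((Q →ₗ[Hᵐᵒᵖ] H) →ₗ[k] k))

variable {k H} in
/-- An element of `ν Q`, as a linear form on `Hom_H(Q, H)`. -/
def Nakayama.form {Q : ModuleCat.{u} Hᵐᵒᵖ} (φ : Nakayama k H Q) : (Q →ₗ[Hᵐᵒᵖ] H) →ₗ[k] k := φ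

variable {k H} in
/-- The action of `a : H` on `ν Q`: `(φ · a) g = φ (a g)`, where `(a g) x = a * g x`. -/
def Nakayama.act {Q : ModuleCat.{u} Hᵐᵒᵖ} (a : H) (φ : Nakayama k H Q) : Nakayama k H Q where
  toFun g := φ.form (a • g)
  map_add' g g' := by rw [smul_add]; exact φ.form.map_add _ _
  map_smul' c g := by rw [smul_comm]; exact φ.form.map_smul _ _

instance (Q : ModuleCat.{u} Hᵐᵒᵖ) : Module Hᵐᵒᵖ (Nakayama k H Q) where
  smul a φ := φ.act a.unop
  one_smul φ := LinearMap.ext fun g => congrArg φ.form (one_smul H g)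
  mul_smul a b φ := LinearMap.ext fun g =>
    congrArg φ.form (mul_smul b.unop a.unop g)
  smul_zero _ := rfl
  smul_add _ _ _ := rfl
  add_smul a b φ := LinearMap.ext fun g =>
    (congrArg φ.form (add_smul a.unop b.unop g)).trans (φ.form.map_add _ _)
  zero_smul φ := LinearMap.ext fun g =>
    (congrArg φ.form (zero_smul H g)).trans φ.form.map_zero

/-- The Nakayama functor on morphisms: `(ν f) φ g = φ (g ∘ f)`. -/
def Nakayama.map {Q Q' : ModuleCat.{u} Hᵐᵒᵖ} (f : Q ⟶ Q') :
    Nakayama k H Q →ₗ[Hᵐᵒᵖ] Nakayama k H Q' where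
  toFun φ :=
    { toFun := fun g => φ.form (g.comp f.hom)
      map_add' := fun g g' => φ.form.map_add (g.comp f.hom) (g'.comp f.hom)
      map_smul' := fun c g => φ.form.map_smul c (g.comp f.hom) }
  map_add' _ _ := rfl
  map_smul' _ _ := rfl

/-- The Auslander-Reiten translate computed from a minimal projective presentation
`Q₁ --f--> Q₀ → T → 0`: `τ T = ker (ν f : ν Q₁ → ν Q₀)`. -/
def tau {Q₁ Q₀ : ModuleCat.{u} Hᵐᵒᵖ} (f : Q₁ ⟶ Q₀) : Submodule Hᵐᵒᵖ (Nakayama k H Q₁) :=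
  LinearMap.ker (Nakayama.map k H f)

/-- `T` is τ-rigid: `Hom_H(T, τ T) = 0`. Minimal projective presentations of `T` are unique up to
isomorphism, so it does not matter which one is used to compute `τ T`. -/
def IsTauRigid (T : ModuleCat.{u} Hᵐᵒᵖ) : Prop :=
  ∃ (Q₁ Q₀ : ModuleCat.{u} Hᵐᵒᵖ) (f : Q₁ ⟶ Q₀) (p : Q₀ ⟶ T),
    IsMinimalProjectivePresentation f p ∧ ∀ g : T →ₗ[Hᵐᵒᵖ] tau k H f, g = 0

/-- `(T, P)` is a support τ-tilting pair in the category of finitely generated right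
`H`-modules. -/
structure IsSupportTauTiltingPair (T P : ModuleCat.{u} Hᵐᵒᵖ) : Prop where
  finite_left : Module.Finite Hᵐᵒᵖ T
  finite_right : Module.Finite Hᵐᵒᵖ P
  projective_right : Module.Projective Hᵐᵒᵖ P
  tauRigid : IsTauRigid k H T
  hom_eq_zero : ∀ g : P →ₗ[Hᵐᵒᵖ] T, g = 0
  numSummands_add : numSummands Hᵐᵒᵖ T + numSummands Hᵐᵒᵖ P = numSummands Hᵐᵒᵖ H

end AuslanderReiten

section Silting

variable (H : Type u) [Ring H]

/-- The homotopy category of cochain complexes of right `H`-modules. -/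
abbrev K : Type _ := HomotopyCategory (ModuleCat.{u} Hᵐᵒᵖ) (ComplexShape.up ℤ)

/-- The class of a complex in the homotopy category. -/
abbrev toK (X : CochainComplex (ModuleCat.{u} Hᵐᵒᵖ) ℤ) : K H :=
  (HomotopyCategory.quotient (ModuleCat.{u} Hᵐᵒᵖ) (ComplexShape.up ℤ)).obj X

/-- All terms of the complex are finitely generated projective. -/
def HasProjTerms (X : CochainComplex (ModuleCat.{u} Hᵐᵒᵖ) ℤ) : Prop :=
  ∀ i, Module.Finite Hᵐᵒᵖ (X.X i) ∧ Module.Projective Hᵐᵒᵖ (X.X i)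

/-- The full subcategory `K^b(proj H)` of the homotopy category: (up to isomorphism) the bounded
complexes of finitely generated projective modules. -/
def Kbproj : ObjectProperty (K H) := fun Y =>
  ∃ X : CochainComplex (ModuleCat.{u} Hᵐᵒᵖ) ℤ, HasProjTerms H X ∧
    (∃ a b : ℤ, ∀ i, i < a ∨ b < i → Limits.IsZero (X.X i)) ∧ Nonempty (Y ≅ toK H X)

/-- A 2-term silting complex in `K^b(proj H)`: a complex of finitely generated projective modules
with non-zero terms only in degrees `-1` and `0`, with `Hom(X, X[i]) = 0` for all `i > 0`, such
that `K^b(proj H)` is the smallest triangulated subcategory closed under direct summands which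
contains `X`. -/
structure IsTwoTermSilting (X : CochainComplex (ModuleCat.{u} Hᵐᵒᵖ) ℤ) : Prop where
  projTerms : HasProjTerms H X
  twoTerm : ∀ i : ℤ, i ≠ -1 → i ≠ 0 → Limits.IsZero (X.X i)
  hom_shift_eq_zero : ∀ i : ℤ, 0 < i → ∀ f : toK H X ⟶ (shiftFunctor (K H) i).obj (toK H X), f = 0
  generates : (ObjectProperty.singleton (toK H X)).triangEnvelope = Kbproj H

variable {H}

/-- The complex `Q₁ ⊕ P --(f, 0)--> Q₀`, with `Q₀` in degree `0`. -/
def twoTermComplex {Q₁ Q₀ : ModuleCat.{u} Hᵐᵒᵖ} (f : Q₁ ⟶ Q₀) (P : ModuleCat.{u} Hᵐᵒᵖ) :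
    CochainComplex (ModuleCat.{u} Hᵐᵒᵖ) ℤ :=
  HomologicalComplex.double (c := ComplexShape.up ℤ) (i₀ := -1) (i₁ := 0)
    (Limits.biprod.desc f (0 : P ⟶ Q₀)) (by simp)

/-- The complex `X` corresponds to the pair `(T, P)`: it is isomorphic in the homotopy category to
`Q₁ ⊕ P --(f, 0)--> Q₀`, where `Q₁ --f--> Q₀ → T → 0` is a minimal projective presentation. -/
def Corresponds (X : CochainComplex (ModuleCat.{u} Hᵐᵒᵖ) ℤ) (T P : ModuleCat.{u} Hᵐᵒᵖ) : Prop :=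
  ∃ (Q₁ Q₀ : ModuleCat.{u} Hᵐᵒᵖ) (f : Q₁ ⟶ Q₀) (p : Q₀ ⟶ T),
    IsMinimalProjectivePresentation f p ∧ Nonempty (toK H X ≅ toK H (twoTermComplex f P))

/-- `A` is a silted algebra with respect to `(T, P)`: `H` is hereditary, `(T, P)` is a basic
support τ-tilting pair over `H`, and `A` is isomorphic to the endomorphism algebra in the derived
category of a 2-term silting complex corresponding to `(T, P)`. The bounded derived category of
finitely generated modules is a full subcategory of the derived category of all modules used
here, so the endomorphism algebra is the same. -/
def IsSiltedWithRespectTo (k : Type v) [Field k] [Algebra k H] (T P : ModuleCat.{u} Hᵐᵒᵖ)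
    (A : Type w) [Ring A] [Algebra k A] : Prop :=
  IsHereditaryAlgebra k H ∧ IsSupportTauTiltingPair k H T P ∧
    IsBasic Hᵐᵒᵖ T ∧ IsBasic Hᵐᵒᵖ P ∧
    ∃ X : CochainComplex (ModuleCat.{u} Hᵐᵒᵖ) ℤ, IsTwoTermSilting H X ∧ Corresponds X T P ∧
      letI := HasDerivedCategory.standard (ModuleCat.{u} Hᵐᵒᵖ)
      Nonempty (A ≃ₐ[k] End (DerivedCategory.Q.obj X))

end Silting

section ExtBimodule

variable {C : Type*} [Category C] [Abelian C] [HasExt.{w} C] {X Y : C} {n : ℕ}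

/-- The left action of `End Y` on `Ext^n(X, Y)` by push-out. -/
instance extLeftModule : Module (End Y) (Abelian.Ext X Y n) where
  smul f x := x.comp (Abelian.Ext.mk₀ f) (add_zero n)
  one_smul x := x.comp_mk₀_id
  mul_smul f g x := by
    change x.comp (Abelian.Ext.mk₀ (g ≫ f)) _ =
      (x.comp (Abelian.Ext.mk₀ g) _).comp (Abelian.Ext.mk₀ f) _
    rw [← Abelian.Ext.mk₀_comp_mk₀, Abelian.Ext.comp_assoc_of_third_deg_zero]
  smul_zero f := Abelian.Ext.zero_comp _ _ _ _ (add_zero n)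
  smul_add f x y := Abelian.Ext.add_comp _ _ _ _
  add_smul f g x := by
    change x.comp (Abelian.Ext.mk₀ (f + g)) _ = _
    rw [Abelian.Ext.mk₀_add, Abelian.Ext.comp_add]
    rfl
  zero_smul x := by
    change x.comp (Abelian.Ext.mk₀ 0) _ = _
    rw [Abelian.Ext.mk₀_zero, Abelian.Ext.comp_zero]

/-- The right action of `End X` on `Ext^n(X, Y)` by pull-back. -/
instance extRightModule : Module (End X)ᵐᵒᵖ (Abelian.Ext X Y n) where
  smul g x := (Abelian.Ext.mk₀ g.unop).comp x (zero_add n)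
  one_smul x := x.mk₀_id_comp
  mul_smul f g x := by
    change (Abelian.Ext.mk₀ (f.unop ≫ g.unop)).comp x _ =
      (Abelian.Ext.mk₀ f.unop).comp ((Abelian.Ext.mk₀ g.unop).comp x _) _
    rw [Abelian.Ext.mk₀_comp_mk₀_assoc]
  smul_zero f := Abelian.Ext.comp_zero _ _ _ _ (zero_add n)
  smul_add f x y := Abelian.Ext.comp_add _ _ _ _
  add_smul f g x := by
    change (Abelian.Ext.mk₀ (f.unop + g.unop)).comp x _ = _
    rw [Abelian.Ext.mk₀_add, Abelian.Ext.add_comp]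
    rfl
  zero_smul x := by
    change (Abelian.Ext.mk₀ 0).comp x _ = _
    rw [Abelian.Ext.mk₀_zero, Abelian.Ext.zero_comp]

instance ext_smulCommClass : SMulCommClass (End Y) (End X)ᵐᵒᵖ (Abelian.Ext X Y n) where
  smul_comm f g x := by
    change ((Abelian.Ext.mk₀ g.unop).comp x _).comp (Abelian.Ext.mk₀ f) _ =
      (Abelian.Ext.mk₀ g.unop).comp (x.comp (Abelian.Ext.mk₀ f) _) _
    rw [Abelian.Ext.comp_assoc_of_third_deg_zero]

variable {k : Type v} [CommRing k] [Linear k C]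

instance ext_isScalarTower_left : IsScalarTower k (End Y) (Abelian.Ext X Y n) where
  smul_assoc c f x := by
    change x.comp (Abelian.Ext.mk₀ (c • (f : Y ⟶ Y))) _ = c • x.comp (Abelian.Ext.mk₀ f) _
    rw [Abelian.Ext.mk₀_smul, Abelian.Ext.comp_smul]

instance ext_isScalarTower_right : IsScalarTower k (End X)ᵐᵒᵖ (Abelian.Ext X Y n) where
  smul_assoc c g x := by
    change (Abelian.Ext.mk₀ (c • (g.unop : X ⟶ X))).comp x _ =
      c • (Abelian.Ext.mk₀ g.unop).comp x _
    rw [Abelian.Ext.mk₀_smul, Abelian.Ext.smul_comp]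

end ExtBimodule

section Triangular

variable (B M C : Type*)

/-- The underlying type of the algebra of lower triangular matrices `[[b, 0], [m, c]]`, with
`b : B`, `m : M` and `c : C`. -/
@[ext]
structure TriangularMatrix where
  b : B
  m : M
  c : C

namespace TriangularMatrix

variable {B M C} [Ring B] [Ring C] [AddCommGroup M]

instance : Zero (TriangularMatrix B M C) := ⟨⟨0, 0, 0⟩⟩
instance : One (TriangularMatrix B M C) := ⟨⟨1, 0, 1⟩⟩
instance : Add (TriangularMatrix B M C) := ⟨fun x y => ⟨x.b + y.b, x.m + y.m, x.c + y.c⟩⟩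
instance : Neg (TriangularMatrix B M C) := ⟨fun x => ⟨-x.b, -x.m, -x.c⟩⟩

@[simp] lemma zero_b : (0 : TriangularMatrix B M C).b = 0 := rfl
@[simp] lemma zero_m : (0 : TriangularMatrix B M C).m = 0 := rfl
@[simp] lemma zero_c : (0 : TriangularMatrix B M C).c = 0 := rfl
@[simp] lemma one_b : (1 : TriangularMatrix B M C).b = 1 := rfl
@[simp] lemma one_m : (1 : TriangularMatrix B M C).m = 0 := rfl
@[simp] lemma one_c : (1 : TriangularMatrix B M C).c = 1 := rfl
@[simp] lemma add_b (x y : TriangularMatrix B M C) : (x + y).b = x.b + y.b := rfl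
@[simp] lemma add_m (x y : TriangularMatrix B M C) : (x + y).m = x.m + y.m := rfl
@[simp] lemma add_c (x y : TriangularMatrix B M C) : (x + y).c = x.c + y.c := rfl
@[simp] lemma neg_b (x : TriangularMatrix B M C) : (-x).b = -x.b := rfl
@[simp] lemma neg_m (x : TriangularMatrix B M C) : (-x).m = -x.m := rfl
@[simp] lemma neg_c (x : TriangularMatrix B M C) : (-x).c = -x.c := rfl
variable {k : Type*} [CommRing k] [Algebra k B] [Algebra k C] [Module k M]

instance : SMul k (TriangularMatrix B M C) := ⟨fun r x => ⟨r • x.b, r • x.m, r • x.c⟩⟩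

@[simp] lemma smul_b (r : k) (x : TriangularMatrix B M C) : (r • x).b = r • x.b := rfl
@[simp] lemma smul_m (r : k) (x : TriangularMatrix B M C) : (r • x).m = r • x.m := rfl
@[simp] lemma smul_c (r : k) (x : TriangularMatrix B M C) : (r • x).c = r • x.c := rfl

variable [Module C M] [Module Bᵐᵒᵖ M]

/-- Multiplication of matrices: `(x y).m = x.m · y.b + x.c · y.m`. -/
instance : Mul (TriangularMatrix B M C) :=
  ⟨fun x y => ⟨x.b * y.b, MulOpposite.op y.b • x.m + x.c • y.m, x.c * y.c⟩⟩

@[simp] lemma mul_b (x y : TriangularMatrix B M C) : (x * y).b = x.b * y.b := rfl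
@[simp] lemma mul_m (x y : TriangularMatrix B M C) :
    (x * y).m = MulOpposite.op y.b • x.m + x.c • y.m := rfl
@[simp] lemma mul_c (x y : TriangularMatrix B M C) : (x * y).c = x.c * y.c := rfl

instance [SMulCommClass C Bᵐᵒᵖ M] : Ring (TriangularMatrix B M C) where
  add_assoc x y z := by ext <;> simp [add_assoc]
  zero_add x := by ext <;> simp
  add_zero x := by ext <;> simp
  add_comm x y := by ext <;> simp [add_comm]
  neg_add_cancel x := by ext <;> simp
  nsmul := nsmulRec
  zsmul := zsmulRec
  left_distrib x y z := by ext <;> simp [mul_add, add_smul, smul_add, add_add_add_comm]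
  right_distrib x y z := by ext <;> simp [add_mul, add_smul, smul_add, add_add_add_comm]
  zero_mul x := by ext <;> simp
  mul_zero x := by ext <;> simp
  mul_assoc x y z := by ext <;> simp [mul_assoc, mul_smul, smul_add, add_assoc, smul_comm]
  one_mul x := by ext <;> simp
  mul_one x := by ext <;> simp

variable [SMulCommClass C Bᵐᵒᵖ M]

instance : Module k (TriangularMatrix B M C) where
  one_smul x := by ext <;> simp
  mul_smul r s x := by ext <;> simp [mul_smul]
  smul_zero r := by ext <;> simp
  smul_add r x y := by ext <;> simp
  add_smul r s x := by ext <;> simp [add_smul]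
  zero_smul x := by ext <;> simp

variable [IsScalarTower k C M] [IsScalarTower k Bᵐᵒᵖ M]

instance : Algebra k (TriangularMatrix B M C) :=
  Algebra.ofModule
    (fun r x y => by
      ext
      · simp
      · simp only [mul_m, smul_m, smul_c, smul_add, smul_assoc]
        rw [← algebraMap_smul Bᵐᵒᵖ r x.m, ← algebraMap_smul Bᵐᵒᵖ r (_ • x.m), smul_smul, smul_smul,
          Algebra.commutes]
      · simp)
    (fun r x y => by
      ext
      · simp
      · simp only [mul_m, smul_b, smul_m, smul_add, MulOpposite.op_smul, smul_assoc]
        rw [← algebraMap_smul C r y.m, ← algebraMap_smul C r (_ • y.m), smul_smul, smul_smul,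
          Algebra.commutes]
      · simp)

end TriangularMatrix

end Triangular

section Idempotents

variable {k : Type v} [Field k] {H : Type u} [Ring H] [Algebra k H] {e : H}

instance cornerSMul (he : IsIdempotentElem e) : SMul k he.Corner where
  smul r x := ⟨r • x.1, by
    have hx := (Subsemigroup.mem_corner_iff he).1 x.2
    exact (Subsemigroup.mem_corner_iff he).2
      ⟨by rw [mul_smul_comm, hx.1], by rw [smul_mul_assoc, hx.2]⟩⟩

instance cornerModule (he : IsIdempotentElem e) : Module k he.Corner where
  one_smul x := Subtype.ext (one_smul k x.1)
  mul_smul r s x := Subtype.ext (mul_smul r s x.1)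
  smul_zero r := Subtype.ext (smul_zero r)
  smul_add r x y := Subtype.ext (smul_add r x.1 y.1)
  add_smul r s x := Subtype.ext (add_smul r s x.1)
  zero_smul x := Subtype.ext (zero_smul k x.1)

/-- The corner `eHe` is a `k`-algebra with unit `e`. -/
instance cornerAlgebra (he : IsIdempotentElem e) : Algebra k he.Corner :=
  Algebra.ofModule (fun r x y => Subtype.ext (smul_mul_assoc r x.1 y.1))
    (fun r x y => Subtype.ext (mul_smul_comm r x.1 y.1))

/-- The right ideal `eH`, as a right `H`-module. -/
abbrev rightIdeal (e : H) : Submodule Hᵐᵒᵖ H := Submodule.span Hᵐᵒᵖ {e}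

/-- The quotient algebra `H/HeH` by the two-sided ideal generated by `e`. -/
abbrev QuotientByIdempotent (e : H) : Type u := (TwoSidedIdeal.span {e}).ringCon.Quotient

/-- A right `H/HeH`-module, regarded as a right `H`-module through `H → H/HeH`. -/
abbrev inflate (e : H) (T : ModuleCat.{u} (QuotientByIdempotent e)ᵐᵒᵖ) : ModuleCat.{u} Hᵐᵒᵖ :=
  (ModuleCat.restrictScalars (RingHom.op (TwoSidedIdeal.span {e}).ringCon.mk')).obj T

end Idempotents

end Silted

end

/-! Over a hereditary algebra the minimal presentation map `f : Q₁ ⟶ Q₀` of `T` is injective,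
because its image is projective and its kernel is therefore a superfluous direct summand. Hence the
two-term complex becomes `T ⊕ P[1]` in the derived category. There `Hom(P[1], T) = 0` for degree
reasons, `Hom(T, P[1]) = Ext¹(T, P)`, and the diagonal entries are `End T` and `End P`; this is the
triangular matrix algebra (`nonempty_end_equiv_triangular_ext`). A right ideal of `End P` is a
direct summand of a finite power of `End P`, since images of maps `Pⁿ → P` are projective
(`IsHereditaryAlgebra.end`).

A basic projective `P` is a quotient of `H`, hence isomorphic to some `eH` (`exists_idempotent`).
Now `Hom(eH, T) = 0` means `Te = 0`, so `T` is a module over `H/HeH`, which is again hereditary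
because `HeH` is an idempotent ideal. Three facts make `T` tilting there (`exists_isTilting`).
Projective dimension at most one is automatic. By the Auslander-Reiten formula, τ-rigidity gives
`Ext¹(T, T) = 0` over `H`, and this descends to the factor algebra (`exists_factor_of_forall_tau`,
`ext_eq_zero_of_surjective`). Finally `|H| = |H/HeH| + |P|`: for projective modules `|·|` counts
simple quotients, and a simple `H`-module is either killed by `e` or a quotient of `eH`
(`card_simpleQuotient_add`). Since `T` has the same endomorphisms over `H` and over `H/HeH`, the
algebra `End T` is tilted. -/

noncomputable section

namespace Silted

/-! ### Retracts and Fitting's lemma; basic modules -/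

section Indecomposable

variable {R : Type*} [Ring R] {M N X : Type*} [AddCommGroup M] [Module R M]
  [AddCommGroup N] [Module R N] [AddCommGroup X] [Module R X]

lemma isCompl_range_ker_of_retract (i : M →ₗ[R] X) (r : X →ₗ[R] M) (h : ∀ x, r (i x) = x) :
    IsCompl (LinearMap.range i) (LinearMap.ker r) := by
  refine ⟨disjoint_iff.2 <| (Submodule.eq_bot_iff _).2 ?_, codisjoint_iff.2 <|
    eq_top_iff.2 fun x _ => ?_⟩
  · rintro _ ⟨⟨y, rfl⟩, hy⟩
    rw [SetLike.mem_coe, LinearMap.mem_ker, h] at hy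
    rw [hy, map_zero]
  · exact Submodule.mem_sup.2 ⟨i (r x), ⟨_, rfl⟩, x - i (r x), by simp [h], by simp⟩

lemma IsIndecomposable.of_equiv (h : IsIndecomposable R M) (e : M ≃ₗ[R] N) :
    IsIndecomposable R N := by
  obtain ⟨hM, h⟩ := h
  refine ⟨e.symm.toEquiv.nontrivial, fun A B hAB => ?_⟩
  have := h _ _ (hAB.map (Submodule.orderIsoMapComap e.symm))
  simpa using! this

/-- A split epimorphism from an indecomposable module to a non-zero module is bijective. -/
lemma IsIndecomposable.bijective_of_retract [Nontrivial M] (h : IsIndecomposable R N)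
    (i : M →ₗ[R] N) (r : N →ₗ[R] M) (hri : ∀ x, r (i x) = x) : Function.Bijective r := by
  refine ⟨?_, fun x => ⟨i x, hri x⟩⟩
  rw [← LinearMap.ker_eq_bot]
  refine (h.2 _ _ (isCompl_range_ker_of_retract i r hri)).resolve_left fun h0 => ?_
  obtain ⟨x, hx⟩ := exists_ne (0 : M)
  apply hx
  rw [← hri x, LinearMap.range_eq_bot.1 h0, LinearMap.zero_apply, map_zero]

/-- Fitting's lemma for an indecomposable module. -/
lemma IsIndecomposable.isNilpotent_or_bijective [IsArtinian R M] [IsNoetherian R M]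
    (h : IsIndecomposable R M) (f : Module.End R M) : IsNilpotent f ∨ Function.Bijective f := by
  -- The exponent is taken non-zero so that `ker f ⊆ ker fⁿ`.
  obtain ⟨n, hn, hn0⟩ := (f.eventually_isCompl_ker_pow_range_pow.and
    (Filter.eventually_ne_atTop 0)).exists
  obtain h0 | h0 := h.2 _ _ hn
  · right
    obtain ⟨n, rfl⟩ := Nat.exists_eq_succ_of_ne_zero hn0
    apply IsArtinian.bijective_of_injective_endomorphism
    rw [← LinearMap.ker_eq_bot, eq_bot_iff, ← h0, pow_succ]
    exact fun x hx => by simp_all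
  · exact Or.inl ⟨n, LinearMap.range_eq_bot.1 h0⟩

end Indecomposable

section Basic

variable {R : Type*} [Ring R] {M : Type*} [AddCommGroup M] [Module R M]

/-- The images of the two coordinates of `N × N` are independent isomorphic summands. Phrased with
retracts, basicness passes to direct summands by composition, as the induction in
`exists_surjective_of_basic` requires. -/
lemma IsBasic.false_of_retract (h : IsBasic R M) {N : Type*} [AddCommGroup N] [Module R N]
    (hN : IsIndecomposable R N) (i : N × N →ₗ[R] M) (r : M →ₗ[R] N × N)
    (hri : ∀ x, r (i x) = x) : False := by
  have hi : Function.Injective i := Function.LeftInverse.injective hri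
  let e₁ := LinearEquiv.ofInjective (i ∘ₗ LinearMap.inl R N N) (hi.comp LinearMap.inl_injective)
  let e₂ := LinearEquiv.ofInjective (i ∘ₗ LinearMap.inr R N N) (hi.comp LinearMap.inr_injective)
  refine (h _ _ (LinearMap.ker r) (hN.of_equiv e₁) (hN.of_equiv e₂) ?_ ?_).false
    (e₁.symm.trans e₂)
  · rw [LinearMap.range_comp, LinearMap.range_comp]
    apply Submodule.disjoint_map hi
    exact LinearMap.isCompl_range_inl_inr.disjoint
  · rw [LinearMap.range_comp, LinearMap.range_comp, ← Submodule.map_sup,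
      LinearMap.isCompl_range_inl_inr.sup_eq_top, Submodule.map_top]
    exact isCompl_range_ker_of_retract i r hri

end Basic

/-! ### Tops of indecomposable projective modules -/

section Top

variable {R : Type*} [Ring R] {N N' S S' : Type*} [AddCommGroup N] [Module R N]
  [AddCommGroup N'] [Module R N'] [AddCommGroup S] [Module R S] [AddCommGroup S'] [Module R S']

/-- An indecomposable projective module of finite length has exactly one maximal submodule. -/
lemma IsIndecomposable.eq_of_isCoatom [IsArtinian R N] [IsNoetherian R N] [Module.Projective R N]
    (h : IsIndecomposable R N) {A B : Submodule R N} (hA : IsCoatom A) (hB : IsCoatom B) :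
    A = B := by
  by_contra hAB
  have hsup : A ⊔ B = ⊤ := hA.sup_eq_top_of_ne hB hAB
  -- As `A + B = N`, already `A` maps onto `N/B`; projectivity of `N` then yields `g : N → A` with
  -- `x - g x ∈ B`.
  have hsurj : Function.Surjective (B.mkQ ∘ₗ A.subtype) := by
    rw [← LinearMap.range_eq_top, LinearMap.range_comp, Submodule.range_subtype,
      Submodule.map_mkQ_eq_top, sup_comm]
    exact hsup
  obtain ⟨g, hg⟩ := Module.projective_lifting_property _ B.mkQ hsurj
  have hgB : ∀ x, x - g x ∈ B := fun x => by
    rw [← Submodule.Quotient.mk_eq_zero B, Submodule.Quotient.mk_sub, sub_eq_zero]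
    exact (LinearMap.congr_fun hg x).symm
  let g' : Module.End R N := A.subtype ∘ₗ g
  -- If `g'` is nilpotent, `1 - g'` is invertible with image in `B`; if `g'` is bijective, its image
  -- in `A` is everything. Either way a maximal submodule would be the whole module.
  obtain hn | hb := h.isNilpotent_or_bijective g'
  · obtain ⟨y, hy⟩ := hn.isUnit_one_sub.exists_right_inv
    refine hB.1 (eq_top_iff.2 fun x _ => ?_)
    rw [← Module.End.one_apply (R := R) x, ← hy]
    exact hgB (y x)
  · refine hA.1 (eq_top_iff.2 fun x _ => ?_)
    obtain ⟨y, rfl⟩ := hb.2 x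
    exact (g y).2

/-- A map to an indecomposable projective module which does not vanish on the simple top is
surjective. -/
lemma IsIndecomposable.surjective_of_comp_ne_zero [IsArtinian R N] [IsNoetherian R N]
    [Module.Projective R N] [IsSimpleModule R S] (h : IsIndecomposable R N) (q : N →ₗ[R] S)
    (g : N' →ₗ[R] N) (hqg : q ∘ₗ g ≠ 0) : Function.Surjective g := by
  have hq : Function.Surjective q := (q.surjective_or_eq_zero).resolve_right fun h0 => hqg (by
    rw [h0, LinearMap.zero_comp])
  rw [← LinearMap.range_eq_top]
  refine (eq_top_or_exists_le_coatom _).resolve_right fun ⟨A, hA, hgA⟩ => hqg ?_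
  rw [h.eq_of_isCoatom hA (LinearMap.isCoatom_ker_of_surjective hq)] at hgA
  exact LinearMap.ext fun x => hgA ⟨x, rfl⟩

lemma exists_lift_of_top [Module.Projective R N'] [IsArtinian R N] [IsNoetherian R N]
    [Module.Projective R N] [IsSimpleModule R S] (h : IsIndecomposable R N) {q : N →ₗ[R] S}
    (hq : q ≠ 0) {q' : N' →ₗ[R] S} (hq' : q' ≠ 0) :
    ∃ g : N' →ₗ[R] N, q ∘ₗ g = q' ∧ Function.Surjective g := by
  obtain ⟨g, hg⟩ := Module.projective_lifting_property q q' (q.surjective_or_eq_zero.resolve_right hq)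
  exact ⟨g, hg, h.surjective_of_comp_ne_zero q g (hg ▸ hq')⟩

/-- Indecomposable projective modules with a common simple quotient are isomorphic. -/
lemma nonempty_equiv_of_top [IsArtinian R N] [IsNoetherian R N]
    [Module.Projective R N] [Module.Projective R N'] [IsSimpleModule R S]
    (h : IsIndecomposable R N) (h' : IsIndecomposable R N') {q : N →ₗ[R] S}
    (hq : q ≠ 0) {q' : N' →ₗ[R] S} (hq' : q' ≠ 0) : Nonempty (N' ≃ₗ[R] N) := by
  obtain ⟨g, -, hg⟩ := exists_lift_of_top h hq hq'
  obtain ⟨s, hs⟩ := Module.projective_lifting_property g LinearMap.id hg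
  have := h.1
  exact ⟨LinearEquiv.ofBijective g (h'.bijective_of_retract s g (LinearMap.congr_fun hs))⟩

/-- Simple quotients of an indecomposable projective module are isomorphic. -/
lemma nonempty_equiv_simple [IsArtinian R N] [IsNoetherian R N]
    [Module.Projective R N] [IsSimpleModule R S] [IsSimpleModule R S']
    (h : IsIndecomposable R N) {q : N →ₗ[R] S}
    (hq : q ≠ 0) {q' : N →ₗ[R] S'} (hq' : q' ≠ 0) : Nonempty (S ≃ₗ[R] S') := by
  have hs := q.surjective_or_eq_zero.resolve_right hq
  have hs' := q'.surjective_or_eq_zero.resolve_right hq'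
  have := h.eq_of_isCoatom (LinearMap.isCoatom_ker_of_surjective hs)
    (LinearMap.isCoatom_ker_of_surjective hs')
  exact ⟨(q.quotKerEquivOfSurjective hs).symm.trans
    ((Submodule.quotEquivOfEq _ _ this).trans (q'.quotKerEquivOfSurjective hs'))⟩

/-- A non-zero map from a module with the descending chain condition is non-zero on some
indecomposable direct summand. -/
lemma exists_indecSummand [IsArtinian R N] (f : N →ₗ[R] S) (hf : f ≠ 0) :
    ∃ L : IndecSummand R N, f ∘ₗ L.1.subtype ≠ 0 := by
  -- A minimal direct summand on which `f` does not vanish is indecomposable: in `L = A ⊕ B` the map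
  -- is non-zero on one of the two parts, and minimality makes that part all of `L`.
  obtain ⟨L, ⟨⟨C, hLC⟩, hL⟩, hmin⟩ := (wellFounded_lt (α := Submodule R N)).has_min
    {L | (∃ C, IsCompl L C) ∧ f ∘ₗ L.subtype ≠ 0}
    ⟨⊤, ⟨⊥, isCompl_top_bot⟩, fun h => hf (LinearMap.ext fun x => LinearMap.congr_fun h ⟨x, trivial⟩)⟩
  have key : ∀ A B : Submodule R L, IsCompl A B → f ∘ₗ L.subtype ∘ₗ A.subtype ≠ 0 → B = ⊥ := by
    intro A B hAB hA
    have hr := isCompl_range_ker_of_retract (L.subtype ∘ₗ A.subtype)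
      (A.projectionOnto B hAB ∘ₗ L.projectionOnto C hLC) (fun x => by simp)
    have := hmin _ ⟨⟨_, hr⟩, fun h => hA (LinearMap.ext fun x => LinearMap.congr_fun h ⟨_, x, rfl⟩)⟩
    rw [LinearMap.range_comp, Submodule.range_subtype, lt_iff_le_and_ne, not_and_not_right] at this
    have hA' := this (Submodule.map_subtype_le _ _)
    have : A = ⊤ := by
      apply Submodule.map_injective_of_injective L.subtype_injective
      rw [hA', Submodule.map_top, Submodule.range_subtype]
    rw [this] at hAB
    simpa using hAB.disjoint
  refine ⟨⟨L, ⟨?_, fun A B hAB => ?_⟩, C, hLC⟩, hL⟩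
  · by_contra h
    rw [not_nontrivial_iff_subsingleton] at h
    exact hL (LinearMap.ext fun x => by rw [Subsingleton.elim x 0, map_zero, map_zero])
  · by_cases hA : f ∘ₗ L.subtype ∘ₗ A.subtype = 0
    · refine Or.inl (key B A hAB.symm fun hB => hL (LinearMap.ext fun x => ?_))
      obtain ⟨a, ha, b, hb, rfl⟩ := Submodule.mem_sup.1 (hAB.sup_eq_top ▸ Submodule.mem_top (x := x))
      rw [map_add]
      have h1 : f a = 0 := LinearMap.congr_fun hA ⟨a, ha⟩
      have h2 : f b = 0 := LinearMap.congr_fun hB ⟨b, hb⟩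
      simp [h1, h2]
    · exact Or.inr (key A B hAB hA)

end Top

/-! ### Invariance under bijective semilinear maps -/

section Semilinear

variable {R R' : Type*} [Ring R] [Ring R'] {φ : R →+* R'} [RingHomSurjective φ]
  {M M' N N' : Type*} [AddCommGroup M] [Module R M] [AddCommGroup M'] [Module R' M']
  [AddCommGroup N] [Module R N] [AddCommGroup N'] [Module R' N']

lemma nonempty_equiv_iff_of_bijective (l : M →ₛₗ[φ] M') (hl : Function.Bijective l)
    (m : N →ₛₗ[φ] N') (hm : Function.Bijective m) :
    Nonempty (M ≃ₗ[R] N) ↔ Nonempty (M' ≃ₗ[R'] N') := by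
  let el := AddEquiv.ofBijective l.toAddMonoidHom hl
  let em := AddEquiv.ofBijective m.toAddMonoidHom hm
  have hel : ∀ x, el x = l x := fun _ => rfl
  have hem : ∀ x, em x = m x := fun _ => rfl
  constructor
  · rintro ⟨e⟩
    refine ⟨(el.symm.trans (e.toAddEquiv.trans em)).toLinearEquiv fun r x => ?_⟩
    obtain ⟨r, rfl⟩ := RingHomSurjective.is_surjective (σ := φ) r
    obtain ⟨x, rfl⟩ := el.surjective x
    have : φ r • el x = el (r • x) := by simp [hel]
    rw [this]
    simp [hem]
  · rintro ⟨e⟩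
    refine ⟨(el.trans (e.toAddEquiv.trans em.symm)).toLinearEquiv fun r x => ?_⟩
    apply em.injective
    simp only [hem, map_smulₛₗ]
    simp [hel, ← hem]

lemma isIndecomposable_iff_of_bijective (l : M →ₛₗ[φ] M') (hl : Function.Bijective l) :
    IsIndecomposable R M ↔ IsIndecomposable R' M' := by
  let e := Submodule.orderIsoMapComapOfBijective l hl
  have h1 : Nontrivial M ↔ Nontrivial M' := (Equiv.ofBijective l hl).nontrivial_congr
  refine and_congr h1 ⟨fun h N L hNL => ?_, fun h N L hNL => ?_⟩
  · simpa using h _ _ ((e.symm.isCompl_iff).1 hNL)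
  · simpa using h _ _ ((e.isCompl_iff).1 hNL)

/-- The restriction of a semilinear map to a submodule and its image. -/
def restrictMap (l : M →ₛₗ[φ] M') (N : Submodule R M) : N →ₛₗ[φ] N.map l where
  toFun x := ⟨l x, x, x.2, rfl⟩
  map_add' _ _ := Subtype.ext (map_add l _ _)
  map_smul' _ _ := Subtype.ext (map_smulₛₗ l _ _)

lemma restrictMap_bijective (l : M →ₛₗ[φ] M') (hl : Function.Injective l) (N : Submodule R M) :
    Function.Bijective (restrictMap l N) := by
  refine ⟨fun x y h => Subtype.ext (hl (congrArg Subtype.val h)), ?_⟩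
  rintro ⟨_, x, hx, rfl⟩
  exact ⟨⟨x, hx⟩, rfl⟩

/-- Surjectivity of `φ` makes the submodule lattices over the two rings coincide, and `|M|` depends
only on this lattice and on isomorphisms between its members. This compares `T` over `H` with `T`
over `H/HeH`. -/
lemma numSummands_eq_of_bijective (l : M →ₛₗ[φ] M') (hl : Function.Bijective l) :
    numSummands R M = numSummands R' M' := by
  let e := Submodule.orderIsoMapComapOfBijective l hl
  refine ENat.card_congr (Quotient.congr (Equiv.subtypeEquiv e.toEquiv fun N => ?_) fun N L => ?_)
  · refine and_congr (isIndecomposable_iff_of_bijective _ (restrictMap_bijective l hl.1 N)) ?_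
    refine ⟨fun ⟨L, hL⟩ => ⟨_, (e.isCompl_iff).1 hL⟩, fun ⟨L, hL⟩ => ⟨e.symm L, ?_⟩⟩
    rw [e.isCompl_iff]
    simpa using hL
  · exact nonempty_equiv_iff_of_bijective _ (restrictMap_bijective l hl.1 N.1) _
      (restrictMap_bijective l hl.1 L.1)

lemma IsBasic.of_bijective (h : IsBasic R M) (l : M →ₛₗ[φ] M') (hl : Function.Bijective l) :
    IsBasic R' M' := by
  let e := Submodule.orderIsoMapComapOfBijective l hl
  suffices ∀ N L C : Submodule R M, IsIndecomposable R' (e N) → IsIndecomposable R' (e L) →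
      Disjoint (e N) (e L) → IsCompl (e N ⊔ e L) (e C) → IsEmpty (e N ≃ₗ[R'] e L) by
    intro N L C
    obtain ⟨N, rfl⟩ := e.surjective N
    obtain ⟨L, rfl⟩ := e.surjective L
    obtain ⟨C, rfl⟩ := e.surjective C
    exact this N L C
  intro N L C hN hL hd hc
  have hN' := (isIndecomposable_iff_of_bijective _ (restrictMap_bijective l hl.1 N)).2 hN
  have hL' := (isIndecomposable_iff_of_bijective _ (restrictMap_bijective l hl.1 L)).2 hL
  rw [← map_sup, ← e.isCompl_iff] at hc
  rw [disjoint_map_orderIso_iff] at hd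
  rw [← not_nonempty_iff]
  intro hne
  exact not_nonempty_iff.2 (h N L C hN' hL' hd hc) ((nonempty_equiv_iff_of_bijective _
    (restrictMap_bijective l hl.1 N) _ (restrictMap_bijective l hl.1 L)).2 hne)

end Semilinear

/-! ### Counting summands of projective modules by simple quotients -/

section Count

variable (R : Type v) [Ring R] (X : Type u) [AddCommGroup X] [Module R X]

/-- The simple modules which are quotients of `X`. -/
def SimpleQuotient : Type (max v (u + 1)) :=
  {S : ModuleCat.{u} R // IsSimpleModule R S ∧ ∃ f : X →ₗ[R] S, f ≠ 0}

/-- Isomorphism of simple quotients, as an equivalence relation. -/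
instance simpleQuotientSetoid : Setoid (SimpleQuotient R X) where
  r S S' := Nonempty (S.1 ≃ₗ[R] S'.1)
  iseqv :=
    { refl := fun S => ⟨LinearEquiv.refl R S.1⟩
      symm := fun ⟨f⟩ => ⟨f.symm⟩
      trans := fun ⟨f⟩ ⟨g⟩ => ⟨f.trans g⟩ }

lemma nonempty_simple_top [IsNoetherian R X] [Nontrivial X] :
    ∃ S : ModuleCat.{u} R, IsSimpleModule R S ∧ ∃ f : X →ₗ[R] S, f ≠ 0 := by
  obtain ⟨A, hA, -⟩ := (eq_top_or_exists_le_coatom (⊥ : Submodule R X)).resolve_left bot_ne_top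
  have hS := isSimpleModule_iff_isCoatom.2 hA
  refine ⟨ModuleCat.of R (X ⧸ A), hS, A.mkQ, fun h => hA.1 ?_⟩
  rw [← A.ker_mkQ, h, LinearMap.ker_zero]

lemma projective_of_isCompl [Module.Projective R X] {N L : Submodule R X} (h : IsCompl N L) :
    Module.Projective R N :=
  Module.Projective.of_split N.subtype (N.projectionOnto L h) (by ext; simp)

/-- The number of indecomposable summands of a projective module of finite length is the number of
its simple quotients. -/
theorem numSummands_eq_card_simpleQuotient [IsArtinian R X] [IsNoetherian R X]
    [Module.Projective R X] :
    numSummands R X = ENat.card (Quotient (simpleQuotientSetoid R X)) := by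
  -- Each indecomposable summand is matched with its top, its only simple quotient up to
  -- isomorphism. The top determines the summand by projectivity, and a non-zero map from `X` to a
  -- simple `S` is non-zero on some summand, whose top is then `S`.
  have key : ∀ N : IndecSummand R X, ∃ S : SimpleQuotient R X, ∃ q : N.1 →ₗ[R] S.1, q ≠ 0 := by
    rintro ⟨N, hN, L, hL⟩
    have := hN.1
    obtain ⟨S, hS, f, hf⟩ := nonempty_simple_top R N
    refine ⟨⟨S, hS, f ∘ₗ N.projectionOnto L hL, fun h => hf ?_⟩, f, hf⟩
    ext x
    simpa using LinearMap.congr_fun h x.1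
  choose t ht using key
  have hiff : ∀ N L : IndecSummand R X, N ≈ L ↔ t N ≈ t L := by
    intro N L
    obtain ⟨q, hq⟩ := ht N
    obtain ⟨q', hq'⟩ := ht L
    have := projective_of_isCompl R X N.2.2.choose_spec
    have := projective_of_isCompl R X L.2.2.choose_spec
    have := (t N).2.1
    have := (t L).2.1
    constructor
    · rintro ⟨e⟩
      refine nonempty_equiv_simple (q' := q' ∘ₗ e.toLinearMap) N.2.1 hq fun h => hq' ?_
      ext x
      simpa using LinearMap.congr_fun h (e.symm x)
    · rintro ⟨e⟩
      refine nonempty_equiv_of_top (q := q') (q' := e.toLinearMap ∘ₗ q) L.2.1 N.2.1 hq' fun h => hq ?_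
      ext x
      simpa using LinearMap.congr_fun h x
  refine ENat.card_congr (Equiv.ofBijective
    (Quotient.map t fun N L h => (hiff N L).1 h) ⟨?_, ?_⟩)
  · rintro ⟨N⟩ ⟨L⟩ h
    exact Quotient.sound ((hiff N L).2 (Quotient.exact h))
  · rintro ⟨S⟩
    obtain ⟨f, hf⟩ := S.2.2
    obtain ⟨N, hN⟩ := exists_indecSummand f hf
    refine ⟨Quotient.mk _ N, Quotient.sound ?_⟩
    obtain ⟨q, hq⟩ := ht N
    have := projective_of_isCompl R X N.2.2.choose_spec
    have := (t N).2.1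
    have := S.2.1
    exact nonempty_equiv_simple N.2.1 hq hN

/-- A module of finite length has finitely many simple quotients. -/
lemma finite_simpleQuotient [IsArtinian R X] [IsNoetherian R X] :
    Finite (Quotient (simpleQuotientSetoid R X)) := by
  -- The list consists of the factors of a composition series: a non-zero map `M → S` is either
  -- non-zero on `N` or induces an isomorphism from the simple factor `M/N`.
  have key : ∀ (Y : Type u) [AddCommGroup Y] [Module R Y], IsFiniteLength R Y →
      ∃ l : List (ModuleCat.{u} R), ∀ S : ModuleCat.{u} R, IsSimpleModule R S →
        ∀ f : Y →ₗ[R] S, f ≠ 0 → ∃ S' ∈ l, Nonempty (S ≃ₗ[R] S') := by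
    intro Y _ _ h
    induction h with
    | of_subsingleton =>
      exact ⟨[], fun S _ f hf => (hf (by ext x; rw [Subsingleton.elim x 0]; simp)).elim⟩
    | @of_simple_quotient M _ _ N _ _ ih =>
      obtain ⟨l, hl⟩ := ih
      refine ⟨ModuleCat.of R (M ⧸ N) :: l, fun S hS f hf => ?_⟩
      by_cases h : f ∘ₗ N.subtype = 0
      · refine ⟨_, List.mem_cons_self, ?_⟩
        let g : M ⧸ N →ₗ[R] S := N.liftQ f fun x hx => LinearMap.congr_fun h ⟨x, hx⟩
        have hg : g ≠ 0 := fun h0 => hf (LinearMap.ext fun x => LinearMap.congr_fun h0 (N.mkQ x))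
        exact ⟨(LinearEquiv.ofBijective g (g.bijective_or_eq_zero.resolve_right hg)).symm⟩
      · obtain ⟨S', hS', e⟩ := hl S hS _ h
        exact ⟨S', List.mem_cons_of_mem _ hS', e⟩
  obtain ⟨l, hl⟩ := key X (isFiniteLength_iff_isNoetherian_isArtinian.2 ⟨‹_›, ‹_›⟩)
  choose t ht ht' using fun S : SimpleQuotient R X =>
    hl S.1 S.2.1 S.2.2.choose S.2.2.choose_spec
  let m : Quotient (simpleQuotientSetoid R X) → {S // S ∈ l} := fun S => ⟨t S.out, ht S.out⟩
  have : Finite {S // S ∈ l} := l.finite_toSet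
  refine Finite.of_injective m fun S S' h => ?_
  have h' : t S.out = t S'.out := congrArg Subtype.val h
  obtain ⟨e⟩ := ht' S.out
  obtain ⟨e'⟩ := ht' S'.out
  rw [h'] at e
  rw [← S.out_eq, ← S'.out_eq]
  exact Quotient.sound ⟨e.trans e'.symm⟩

end Count

/-! ### Modules and simple modules over a factor ring -/

section Quotient

variable {R R' : Type*} [Ring R] [Ring R']

/-- A module killed by the kernel of a surjective ring homomorphism `R → R'`, as a module over
`R'`. -/
@[reducible]
def moduleOfSurjective (φ : R →+* R') (hφ : Function.Surjective φ) (M : Type*) [AddCommGroup M]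
    [Module R M] (h : ∀ r, φ r = 0 → ∀ x : M, r • x = 0) : Module R' M :=
  have key : ∀ r s, φ r = φ s → ∀ x : M, r • x = s • x := fun r s hrs x => by
    rw [← sub_eq_zero, ← sub_smul]
    exact h _ (by rw [map_sub, hrs, sub_self]) x
  have hs := Function.surjInv_eq hφ
  { smul := fun r x => Function.surjInv hφ r • x
    one_smul := fun x => (key _ 1 (by rw [hs, map_one]) x).trans (one_smul R x)
    mul_smul := fun r s x => (key _ (Function.surjInv hφ r * Function.surjInv hφ s)
      (by rw [hs, map_mul, hs, hs]) x).trans (mul_smul _ _ _)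
    smul_zero := fun r => smul_zero _
    smul_add := fun r => smul_add _
    add_smul := fun r s x => (key _ (Function.surjInv hφ r + Function.surjInv hφ s)
      (by rw [hs, map_add, hs, hs]) x).trans (add_smul _ _ _)
    zero_smul := fun x => (key _ 0 (by rw [hs, map_zero]) x).trans (zero_smul R x) }

lemma moduleOfSurjective_smul (φ : R →+* R') (hφ : Function.Surjective φ) (M : Type*)
    [AddCommGroup M] [Module R M] (h : ∀ r, φ r = 0 → ∀ x : M, r • x = 0) (r : R) (x : M) :
    letI := moduleOfSurjective φ hφ M h
    φ r • x = r • x := by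
  change Function.surjInv hφ (φ r) • x = r • x
  rw [← sub_eq_zero, ← sub_smul]
  exact h _ (by rw [map_sub, Function.surjInv_eq hφ, sub_self]) x

end Quotient

section QuotientCount

variable {R R' : Type v} [Ring R] [Ring R'] (φ : R →+* R') (hφ : Function.Surjective φ)
  (X Y Y' : Type u) [AddCommGroup X] [Module R X] [AddCommGroup Y] [Module R Y]
  [AddCommGroup Y'] [Module R' Y']

include hφ in
/-- If every simple `R`-module is a quotient of `Y`, every simple `R'`-module is a quotient of `Y'`
and the simple quotients of `X` are those which are not killed by the kernel of `R → R'`, then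
the numbers of simple quotients add up. -/
theorem card_simpleQuotient_add
    (hY : ∀ S : ModuleCat.{u} R, IsSimpleModule R S → ∃ f : Y →ₗ[R] S, f ≠ 0)
    (hY' : ∀ S : ModuleCat.{u} R', IsSimpleModule R' S → ∃ f : Y' →ₗ[R'] S, f ≠ 0)
    (hX : ∀ S : ModuleCat.{u} R, IsSimpleModule R S →
      ((∀ f : X →ₗ[R] S, f = 0) ↔ ∀ r, φ r = 0 → ∀ x : S, r • x = 0)) :
    ENat.card (Quotient (simpleQuotientSetoid R' Y')) +
      ENat.card (Quotient (simpleQuotientSetoid R X)) =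
      ENat.card (Quotient (simpleQuotientSetoid R Y)) := by
  have : RingHomSurjective φ := ⟨hφ⟩
  let l (S : ModuleCat.{u} R') : (ModuleCat.restrictScalars φ).obj S →ₛₗ[φ] S :=
    { toFun := fun x => x
      map_add' := fun _ _ => rfl
      map_smul' := fun _ _ => rfl }
  have hl : ∀ S, Function.Bijective (l S) := fun S => Function.bijective_id
  let a : SimpleQuotient R' Y' → SimpleQuotient R Y := fun S =>
    have hS := ((l S.1).isSimpleModule_iff_of_bijective (hl S.1)).2 S.2.1
    ⟨(ModuleCat.restrictScalars φ).obj S.1, hS, hY _ hS⟩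
  let b : SimpleQuotient R X → SimpleQuotient R Y := fun S => ⟨S.1, S.2.1, hY _ S.2.1⟩
  rw [← ENat.card_sum]
  refine ENat.card_congr (Equiv.ofBijective (Sum.elim
    (Quotient.map a fun S S' => (nonempty_equiv_iff_of_bijective _ (hl _) _ (hl _)).2)
    (Quotient.map b fun S S' h => h)) ⟨?_, ?_⟩)
  -- The two families are disjoint: modules coming from `R'` are killed by `ker φ`, whereas by `hX`
  -- a simple quotient of `X` is not.
  · have hab : ∀ S S', ¬ (a S ≈ b S') := by
      rintro S S' ⟨e⟩
      obtain ⟨f, hf⟩ := S'.2.2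
      refine hf ((hX S'.1 S'.2.1).2 (fun r hr x => ?_) f)
      apply e.symm.injective
      rw [map_smul, map_zero]
      change φ r • (e.symm x : S.1) = 0
      rw [hr, zero_smul]
    rintro (S | S) (S' | S') h <;> obtain ⟨S, rfl⟩ := Quotient.exists_rep S <;>
      obtain ⟨S', rfl⟩ := Quotient.exists_rep S'
    · exact congrArg _ (Quotient.sound
        ((nonempty_equiv_iff_of_bijective _ (hl _) _ (hl _)).1 (Quotient.exact h)))
    · exact (hab _ _ (Quotient.exact h)).elim
    · exact (hab _ _ (Setoid.symm (Quotient.exact h))).elim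
    · exact congrArg _ (Quotient.sound (show S ≈ S' from (Quotient.exact h : b S ≈ b S')))
  · rintro ⟨S⟩
    by_cases h : ∀ f : X →ₗ[R] S.1, f = 0
    · rw [hX S.1 S.2.1] at h
      let := moduleOfSurjective φ hφ S.1 h
      let m : S.1 →ₛₗ[φ] ModuleCat.of R' S.1 :=
        { toFun := fun x => x
          map_add' := fun _ _ => rfl
          map_smul' := fun r x => (moduleOfSurjective_smul φ hφ S.1 h r x).symm }
      have hm : Function.Bijective m := Function.bijective_id
      have hS := (m.isSimpleModule_iff_of_bijective hm).1 S.2.1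
      refine ⟨Sum.inl (Quotient.mk _ ⟨ModuleCat.of R' S.1, hS, hY' _ hS⟩), Quotient.sound ?_⟩
      exact (nonempty_equiv_iff_of_bijective _ (hl _) m hm).2 ⟨LinearEquiv.refl _ _⟩
    · push Not at h
      exact ⟨Sum.inr (Quotient.mk _ ⟨S.1, S.2.1, h⟩), rfl⟩

end QuotientCount

/-! ### Basic projective modules as quotients -/

section BasicProjective

variable {R : Type v} [Ring R]

/-- A basic projective module is a quotient of every projective module which has all its simple
quotients. -/
theorem exists_surjective_of_basic (X : Type u) [AddCommGroup X] [Module R X] [IsArtinian R X]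
    [IsNoetherian R X] [Module.Projective R X]
    (hX : ∀ (N : Type u) [AddCommGroup N] [Module R N], IsIndecomposable R N →
      ∀ (i : N × N →ₗ[R] X) (r : X →ₗ[R] N × N), ¬ ∀ x, r (i x) = x)
    (Y : Type u) [AddCommGroup Y] [Module R Y] [IsArtinian R Y] [IsNoetherian R Y]
    [Module.Projective R Y]
    (h : ∀ S : ModuleCat.{u} R, IsSimpleModule R S → (∃ f : X →ₗ[R] S, f ≠ 0) →
      ∃ f : Y →ₗ[R] S, f ≠ 0) :
    ∃ g : Y →ₗ[R] X, Function.Surjective g := by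
  -- Split off from `X` an indecomposable summand `N` with a simple quotient `S`. As `S` is also a
  -- quotient of `Y`, there is a split surjection `ψ : Y → N`, and the induction hypothesis is
  -- applied to the complements `C` and `ker ψ`.
  induction hn : Module.length R X using WellFoundedLT.induction generalizing X Y with
  | ind n ih =>
  obtain hX0 | hX0 := subsingleton_or_nontrivial X
  · exact ⟨0, fun x => ⟨0, Subsingleton.elim _ _⟩⟩
  obtain ⟨S, hS, f, hf⟩ := nonempty_simple_top R X
  obtain ⟨⟨N, hN, C, hNC⟩, hNf⟩ := exists_indecSummand f hf
  dsimp only at hNf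
  obtain ⟨q, hq⟩ := h S hS ⟨f, hf⟩
  have := projective_of_isCompl R X hNC
  have := projective_of_isCompl R X hNC.symm
  obtain ⟨ψ, -, hψ⟩ := exists_lift_of_top hN hNf hq
  obtain ⟨s, hs⟩ := Module.projective_lifting_property ψ LinearMap.id hψ
  replace hs : ∀ x, ψ (s x) = x := LinearMap.congr_fun hs
  have := projective_of_isCompl R Y (isCompl_range_ker_of_retract s ψ hs).symm
  have hCX : C ≠ ⊤ := by
    rintro rfl
    have := hN.1
    exact (Submodule.nontrivial_iff_ne_bot.1 this) (by simpa using hNC.disjoint)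
  obtain ⟨g, hg⟩ := ih _ (hn ▸ Submodule.length_lt hCX) C
    (fun N' _ _ hN' i r hir => hX N' hN' (C.subtype ∘ₗ i) (r ∘ₗ C.projectionOnto N hNC.symm)
      fun x => by simp [hir]) (LinearMap.ker ψ) (fun S' hS' => by
      rintro ⟨p, hp⟩
      obtain ⟨q', hq'⟩ := h S' hS' ⟨p ∘ₗ C.projectionOnto N hNC.symm, fun h0 => hp (by
        ext x
        simpa using LinearMap.congr_fun h0 x.1)⟩
      -- If `q'` vanished on `ker ψ`, it would be non-zero on the copy `s N` of `N`. Then `S'` would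
      -- be a quotient both of `N` and of an indecomposable summand `L` of `C`, so `N ≅ L` and `N ×
      -- N` would be a retract of `X`.
      refine ⟨q' ∘ₗ (LinearMap.ker ψ).subtype, fun h0 => ?_⟩
      have hqs : q' ∘ₗ s ≠ 0 := fun h1 => hq' (by
        ext y
        have h2 := LinearMap.congr_fun h0 ⟨y - s (ψ y), by simp [hs]⟩
        have h3 := LinearMap.congr_fun h1 (ψ y)
        simp only [LinearMap.comp_apply, Submodule.subtype_apply, map_sub,
          LinearMap.zero_apply] at h2 h3
        rw [h3, sub_zero] at h2
        exact h2)
      obtain ⟨⟨L, hL, D, hLD⟩, hLp⟩ := exists_indecSummand p hp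
      have := projective_of_isCompl R C hLD
      obtain ⟨e⟩ := nonempty_equiv_of_top hN hL hqs hLp
      refine hX N hN (N.subtype.coprod (C.subtype ∘ₗ L.subtype ∘ₗ e.symm.toLinearMap))
        ((N.projectionOnto C hNC).prod (e.toLinearMap ∘ₗ L.projectionOnto D hLD ∘ₗ
          C.projectionOnto N hNC.symm)) fun x => ?_
      ext <;> simp) rfl
  refine ⟨N.subtype ∘ₗ ψ + C.subtype ∘ₗ g ∘ₗ
    (LinearMap.id - s ∘ₗ ψ).codRestrict (LinearMap.ker ψ) (fun y => by simp [hs]), fun x => ?_⟩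
  obtain ⟨a, ha, c, hc, rfl⟩ := Submodule.mem_sup.1 (hNC.sup_eq_top ▸ Submodule.mem_top (x := x))
  obtain ⟨y, hy⟩ := hg ⟨c, hc⟩
  have hy0 : ψ y = 0 := y.2
  refine ⟨s ⟨a, ha⟩ + y, ?_⟩
  have : (LinearMap.id - s ∘ₗ ψ).codRestrict (LinearMap.ker ψ) (fun y => by simp [hs])
      (s ⟨a, ha⟩ + y) = y := Subtype.ext (by simp [hs, hy0])
  simp only [LinearMap.add_apply, LinearMap.comp_apply, this]
  simp [hs, hy0, hy]

end BasicProjective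

/-! ### Projectivity of submodules over hereditary algebras -/

section Hereditary

/-- All submodules of `M` are projective. -/
def SubmodulesProjective (R : Type*) [Ring R] (M : Type*) [AddCommGroup M] [Module R M] : Prop :=
  ∀ N : Submodule R M, Module.Projective R N

variable {R : Type*} [Ring R] {M N : Type*} [AddCommGroup M] [Module R M]
  [AddCommGroup N] [Module R N]

lemma SubmodulesProjective.of_injective (h : SubmodulesProjective R N) (f : M →ₗ[R] N)
    (hf : Function.Injective f) : SubmodulesProjective R M := fun L =>
  have := h (L.map f)
  Module.Projective.of_equiv (Submodule.equivMapOfInjective f hf L).symm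

/-- The image of `L` in `N` is projective, so `L` splits as this image plus the kernel of `L → N`,
and that kernel embeds in `M`. -/
lemma SubmodulesProjective.prod (hM : SubmodulesProjective R M) (hN : SubmodulesProjective R N) :
    SubmodulesProjective R (M × N) := fun L => by
  let g : L →ₗ[R] N := LinearMap.snd R M N ∘ₗ L.subtype
  let f : LinearMap.ker g →ₗ[R] M := LinearMap.fst R M N ∘ₗ L.subtype ∘ₗ (LinearMap.ker g).subtype
  have hf : Function.Injective f := by
    intro x y hxy
    have hx : x.1.1.2 = 0 := x.2
    have hy : y.1.1.2 = 0 := y.2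
    exact Subtype.ext (Subtype.ext (Prod.ext hxy (hx.trans hy.symm)))
  have := hN (LinearMap.range g)
  have : Module.Projective R (LinearMap.ker g) :=
    have := hM (LinearMap.range f)
    Module.Projective.of_equiv (LinearEquiv.ofInjective f hf).symm
  obtain ⟨s, hs⟩ := Module.projective_lifting_property g.rangeRestrict LinearMap.id
    g.surjective_rangeRestrict
  replace hs : ∀ x, g.rangeRestrict (s x) = x := LinearMap.congr_fun hs
  have hs' : ∀ x, g (s x) = x := fun x => congrArg Subtype.val (hs x)
  refine Module.Projective.of_split
    ((LinearMap.codRestrict (LinearMap.ker g) (LinearMap.id - s ∘ₗ g.rangeRestrict) (fun x => by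
      simp [hs'])).prod g.rangeRestrict) ((LinearMap.ker g).subtype.coprod s) ?_
  ext x <;> simp

lemma SubmodulesProjective.pi (h : SubmodulesProjective R M) (n : ℕ) :
    SubmodulesProjective R (Fin n → M) := by
  induction n with
  | zero => exact fun L => inferInstance
  | succ n ih =>
    exact (h.prod ih).of_injective (Fin.consLinearEquiv R (fun _ => M)).symm.toLinearMap
      (LinearEquiv.injective _)

lemma SubmodulesProjective.of_finite_projective (h : SubmodulesProjective R R)
    [Module.Finite R M] [Module.Projective R M] : SubmodulesProjective R M := by
  obtain ⟨n, f, hf⟩ := Module.Finite.exists_fin' R M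
  obtain ⟨s, hs⟩ := Module.projective_lifting_property f LinearMap.id hf
  exact (h.pi n).of_injective s (Function.LeftInverse.injective (LinearMap.congr_fun hs))

end Hereditary

section RightModules

variable {H : Type*} [Ring H]

/-- The regular right module. -/
def regularEquiv (H : Type*) [Ring H] : H ≃ₗ[Hᵐᵒᵖ] Hᵐᵒᵖ where
  __ := MulOpposite.opAddEquiv
  map_smul' _ _ := rfl

instance : Module.Finite Hᵐᵒᵖ H := Module.Finite.equiv (regularEquiv H).symm

instance : Module.Projective Hᵐᵒᵖ H := Module.Projective.of_equiv (regularEquiv H).symm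

end RightModules

section HereditaryAlgebra

variable {k : Type v} [Field k] {H : Type u} [Ring H] [Algebra k H]

lemma IsHereditaryAlgebra.isArtinianRing (h : IsHereditaryAlgebra k H) : IsArtinianRing Hᵐᵒᵖ :=
  have := h.finiteDimensional
  IsArtinianRing.of_finite k Hᵐᵒᵖ

lemma IsHereditaryAlgebra.submodulesProjective (h : IsHereditaryAlgebra k H) (M : Type*)
    [AddCommGroup M] [Module Hᵐᵒᵖ M] [Module.Finite Hᵐᵒᵖ M] [Module.Projective Hᵐᵒᵖ M] :
    SubmodulesProjective Hᵐᵒᵖ M :=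
  (SubmodulesProjective.of_injective h.projective_rightIdeal (regularEquiv H).symm.toLinearMap
    (LinearEquiv.injective _)).of_finite_projective

end HereditaryAlgebra

/-! ### Endomorphism algebras of projective modules are hereditary -/

section EndHereditary

variable {k : Type v} [Field k] {H : Type u} [Ring H] [Algebra k H]

instance (P : ModuleCat.{u} Hᵐᵒᵖ) [FiniteDimensional k H] [Module.Finite Hᵐᵒᵖ P] :
    FiniteDimensional k (End P) := by
  let := Module.restrictScalars k Hᵐᵒᵖ P
  have := IsScalarTower.restrictScalars k Hᵐᵒᵖ P
  have : Module.Finite k P := Module.Finite.trans Hᵐᵒᵖ P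
  let f : End P →ₗ[k] (P →ₗ[k] P) :=
    { toFun := fun g => g.hom.restrictScalars k
      map_add' := fun _ _ => rfl
      map_smul' := fun _ _ => rfl }
  refine FiniteDimensional.of_injective f fun x y h => ?_
  exact ModuleCat.hom_ext (LinearMap.ext fun a => LinearMap.congr_fun h a)

/-- Generators `j i` of a right ideal `J` define `p : Pⁿ → P`, whose image is projective as a
submodule of `P`, so `p` has a section `s` over its image. Every `f ∈ J` has image in that of `p`,
whence `f = ∑ j i * (sᵢ ∘ f)`, and `J` is a retract of `(End P)ⁿ`. -/
lemma IsHereditaryAlgebra.end (h : IsHereditaryAlgebra k H) (P : ModuleCat.{u} Hᵐᵒᵖ)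
    [Module.Finite Hᵐᵒᵖ P] [Module.Projective Hᵐᵒᵖ P] : IsHereditaryAlgebra k (End P) := by
  have := h.finiteDimensional
  refine ⟨inferInstance, fun J => ?_⟩
  have : IsArtinianRing (End P)ᵐᵒᵖ := IsArtinianRing.of_finite k _
  obtain ⟨n, j, hj⟩ := Submodule.fg_iff_exists_fin_generating_family.1
    (IsNoetherian.noetherian (R := (End P)ᵐᵒᵖ) J)
  have hjJ : ∀ i, j i ∈ J := fun i => hj ▸ Submodule.subset_span ⟨i, rfl⟩
  let p : (Fin n → P) →ₗ[Hᵐᵒᵖ] P := LinearMap.lsum Hᵐᵒᵖ (fun _ => P) ℕ fun i => (j i).hom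
  have hp : ∀ x, p x = ∑ i, (j i).hom (x i) := fun x => by simp [p, LinearMap.lsum_apply]
  have := h.submodulesProjective P (LinearMap.range p)
  obtain ⟨s, hs⟩ := Module.projective_lifting_property p.rangeRestrict LinearMap.id
    p.surjective_rangeRestrict
  replace hs : ∀ x, p (s x) = x := fun x => congrArg Subtype.val (LinearMap.congr_fun hs x)
  have hJ : ∀ f ∈ J, ∀ x, (f : End P).hom x ∈ LinearMap.range p := by
    intro f hf x
    rw [← hj] at hf
    induction hf using Submodule.span_induction generalizing x with
    | mem f hf =>
      obtain ⟨i, rfl⟩ := hf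
      refine ⟨Pi.single i x, ?_⟩
      rw [hp, Finset.sum_eq_single i]
      · simp
      · intro b _ hb; simp [hb]
      · simp
    | zero => exact ⟨0, by simp⟩
    | add f g _ _ hf hg => exact add_mem (hf x) (hg x)
    | smul a f _ hf => exact hf (a.unop.hom x)
  let a : J →ₗ[(End P)ᵐᵒᵖ] (Fin n → End P) :=
    { toFun := fun f i => ModuleCat.ofHom (LinearMap.proj i ∘ₗ s ∘ₗ
        LinearMap.codRestrict (LinearMap.range p) f.1.hom (hJ f.1 f.2))
      map_add' := fun f g => by
        ext i x
        exact congrFun (s.map_add ⟨f.1.hom x, hJ _ f.2 x⟩ ⟨g.1.hom x, hJ _ g.2 x⟩) i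
      map_smul' := fun r f => rfl }
  let b : (Fin n → End P) →ₗ[(End P)ᵐᵒᵖ] J :=
    { toFun := fun g => ⟨∑ i, j i * g i, J.sum_mem fun i _ => J.smul_mem (MulOpposite.op (g i)) (hjJ i)⟩
      map_add' := fun f g => Subtype.ext (by simp [mul_add, Finset.sum_add_distrib])
      map_smul' := fun r f => Subtype.ext (by simp [Finset.sum_mul]) }
  have : Module.Projective (End P)ᵐᵒᵖ (Fin n → End P) := Module.Projective.of_equiv
    (DFinsupp.linearEquivFunOnFintype (R := (End P)ᵐᵒᵖ) (M := fun _ : Fin n => End P))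
  refine Module.Projective.of_split a b (LinearMap.ext fun f => Subtype.ext
    (ModuleCat.hom_ext (LinearMap.ext fun x => ?_)))
  refine Eq.trans ?_ (hs ⟨f.1.hom x, hJ _ f.2 x⟩)
  rw [hp]
  change (∑ i, j i * a f i : End P).hom x = _
  rw [ModuleCat.hom_sum, LinearMap.sum_apply]
  rfl

end EndHereditary

/-! ### Reduction modulo `HeH` -/

section Factor

variable {R R' : Type*} [Ring R] [Ring R'] {φ : R →+* R'} {M M' : Type*} [AddCommGroup M]
  [Module R M] [AddCommGroup M'] [Module R' M']

/-- Reduction of a projective module modulo an ideal. -/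
lemma projective_of_semilinear [Module.Projective R M] (hφ : Function.Surjective φ)
    (π : M →ₛₗ[φ] M') (hπ : Function.Surjective π)
    (hker : ∀ x, π x = 0 → x ∈ Submodule.span R {y : M | ∃ r z, φ r = 0 ∧ y = r • z}) :
    Module.Projective R' M' := by
  obtain ⟨s, hs⟩ := Module.projective_def.1 (inferInstance : Module.Projective R M)
  -- Coefficients are reduced along `φ`. Since `ker π` lies in `(ker φ)M`, the map `m ∘ s` kills it
  -- and descends to a section of the map from the free `R'`-module on `M` to `M'`.
  let m : (M →₀ R) →ₛₗ[φ] (M →₀ R') :=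
    { Finsupp.mapRange.addMonoidHom φ.toAddMonoidHom with
      map_smul' := fun r x => by ext; simp }
  have hm : ∀ x, π x = 0 → m (s x) = 0 := by
    intro x hx
    have hx' := hker x hx
    clear hx
    induction hx' using Submodule.span_induction with
    | mem x hx =>
      obtain ⟨r, z, hr, rfl⟩ := hx
      rw [map_smul, map_smulₛₗ, hr, zero_smul]
    | zero => simp
    | add x y _ _ hx hy => rw [map_add, map_add, hx, hy, add_zero]
    | smul r x _ hx => rw [map_smul, map_smulₛₗ, hx, smul_zero]
  let b : (M →₀ R') →ₗ[R'] M' := Finsupp.linearCombination R' π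
  have hb : ∀ v, b (m v) = π (Finsupp.linearCombination R id v) := by
    intro v
    induction v using Finsupp.induction_linear with
    | zero => simp
    | add v w hv hw => simp [hv, hw]
    | single x r => simp [b, m]
  have hc : ∀ x y, π x = π y → m (s x) = m (s y) := fun x y h => by
    rw [← sub_eq_zero, ← map_sub, ← map_sub]
    exact hm _ (by rw [map_sub, h, sub_self])
  have hi := Function.surjInv_eq hπ
  let a : M' →ₗ[R'] (M →₀ R') :=
    { toFun := fun y => m (s (Function.surjInv hπ y))
      map_add' := fun x y => by
        rw [← map_add, ← map_add]
        exact hc _ _ (by rw [map_add, hi, hi, hi])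
      map_smul' := fun r y => by
        obtain ⟨r, rfl⟩ := hφ r
        rw [RingHom.id_apply, ← map_smulₛₗ, ← map_smul]
        exact hc _ _ (by rw [map_smulₛₗ, hi, hi]) }
  refine Module.Projective.of_split a b (LinearMap.ext fun y => ?_)
  exact (hb _).trans ((congrArg π (hs _)).trans (hi y))

end Factor

section FactorAlgebra

variable {H : Type u} [Ring H] (e : H)

/-- The projection `H → H/HeH`, between the opposite rings. -/
abbrev factorMap : Hᵐᵒᵖ →+* (QuotientByIdempotent e)ᵐᵒᵖ :=
  RingHom.op (TwoSidedIdeal.span {e}).ringCon.mk'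

lemma factorMap_surjective : Function.Surjective (factorMap e) := by
  intro x
  obtain ⟨y, hy⟩ := RingCon.mk'_surjective (TwoSidedIdeal.span {e}).ringCon x.unop
  exact ⟨MulOpposite.op y, MulOpposite.unop_injective hy⟩

instance : RingHomSurjective (factorMap e) := ⟨factorMap_surjective e⟩

lemma mk'_eq_zero_iff {x : H} :
    (TwoSidedIdeal.span {e}).ringCon.mk' x = 0 ↔ x ∈ TwoSidedIdeal.span {e} := by
  rw [TwoSidedIdeal.mem_iff]
  exact (TwoSidedIdeal.span ({e} : Set H)).ringCon.eq

open scoped Pointwise in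
lemma mem_span_iff_mem_closure {x : H} :
    x ∈ TwoSidedIdeal.span {e} ↔ x ∈ AddSubgroup.closure {y | ∃ a b, y = a * e * b} := by
  rw [TwoSidedIdeal.mem_span_iff_mem_addSubgroup_closure]
  have : (Set.univ * {e} * Set.univ : Set H) = {y | ∃ a b, y = a * e * b} := by
    ext y
    simp [Set.mem_mul, eq_comm]
  rw [this]

lemma factorMap_eq_zero_iff {r : Hᵐᵒᵖ} :
    factorMap e r = 0 ↔ r.unop ∈ TwoSidedIdeal.span {e} := by
  rw [← mk'_eq_zero_iff, ← MulOpposite.unop_eq_zero_iff]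
  rfl

lemma self_mem_span : e ∈ TwoSidedIdeal.span {e} :=
  TwoSidedIdeal.subset_span (Set.mem_singleton e)

/-- A module is killed by `HeH` if and only if it is killed by `e`. -/
lemma forall_factorMap_smul_iff (M : Type*) [AddCommGroup M] [Module Hᵐᵒᵖ M] :
    (∀ r, factorMap e r = 0 → ∀ x : M, r • x = 0) ↔ ∀ x : M, MulOpposite.op e • x = 0 := by
  refine ⟨fun h x => h _ ((factorMap_eq_zero_iff e).2 (self_mem_span e)) x, fun h r hr x => ?_⟩
  rw [factorMap_eq_zero_iff, mem_span_iff_mem_closure] at hr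
  rw [← MulOpposite.op_unop r]
  generalize r.unop = s at hr
  induction hr using AddSubgroup.closure_induction with
  | mem y hy =>
    obtain ⟨a, b, rfl⟩ := hy
    rw [MulOpposite.op_mul, MulOpposite.op_mul, mul_smul, mul_smul, h, smul_zero]
  | zero => simp
  | add y z _ _ hy hz => rw [MulOpposite.op_add, add_smul, hy, hz, add_zero]
  | neg y _ hy => rw [MulOpposite.op_neg, neg_smul, hy, neg_zero]

variable {e}

lemma mem_rightIdeal (y : rightIdeal e) : ∃ b, (y : H) = e * b := by
  obtain ⟨r, hr⟩ := Submodule.mem_span_singleton.1 y.2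
  exact ⟨r.unop, hr.symm⟩

lemma mul_mem_rightIdeal (b : H) : e * b ∈ rightIdeal e :=
  Submodule.mem_span_singleton.2 ⟨MulOpposite.op b, rfl⟩

lemma idempotent_mul_rightIdeal (he : IsIdempotentElem e) (y : rightIdeal e) :
    e * (y : H) = y := by
  obtain ⟨b, hb⟩ := mem_rightIdeal y
  rw [hb, ← mul_assoc, he.eq]

/-- The generator `e` of `eH`. -/
def rightIdealGen (e : H) : rightIdeal e := ⟨e, Submodule.mem_span_singleton_self e⟩

lemma op_smul_rightIdealGen (he : IsIdempotentElem e) (y : rightIdeal e) :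
    MulOpposite.op (y : H) • rightIdealGen e = y :=
  Subtype.ext (idempotent_mul_rightIdeal he y)

/-- `Hom_H(eH, M) = 0` if and only if `M e = 0`. -/
lemma forall_rightIdeal_hom_eq_zero_iff (he : IsIdempotentElem e) (M : Type*) [AddCommGroup M]
    [Module Hᵐᵒᵖ M] :
    (∀ f : rightIdeal e →ₗ[Hᵐᵒᵖ] M, f = 0) ↔ ∀ x : M, MulOpposite.op e • x = 0 := by
  constructor
  · intro h x
    let f : rightIdeal e →ₗ[Hᵐᵒᵖ] M :=
      { toFun := fun y => MulOpposite.op (y : H) • x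
        map_add' := fun y z => by
          rw [← add_smul]
          rfl
        map_smul' := fun r y => by
          rw [RingHom.id_apply, ← mul_smul]
          rfl }
    exact LinearMap.congr_fun (h f) (rightIdealGen e)
  · intro h f
    ext y
    rw [← op_smul_rightIdealGen he y, map_smul, ← op_smul_rightIdealGen he (rightIdealGen e),
      map_smul]
    simp [rightIdealGen, h]

variable {k : Type v} [Field k] [Algebra k H]

/-- A right ideal of `H/HeH` is `J/HeH` for a right ideal `J ⊇ HeH`, which is projective. Because
`HeH` is idempotent, `HeH = J·HeH`, so `J/HeH` is the reduction of `J` modulo `HeH` and stays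
projective. -/
lemma IsHereditaryAlgebra.quotientByIdempotent (h : IsHereditaryAlgebra k H)
    (he : IsIdempotentElem e) : IsHereditaryAlgebra k (QuotientByIdempotent e) := by
  have := h.finiteDimensional
  refine ⟨Module.Finite.of_surjective ((TwoSidedIdeal.span {e}).ringCon.mkₐ k).toLinearMap
    (RingCon.mk'_surjective _), fun J' => ?_⟩
  let p := (TwoSidedIdeal.span {e}).ringCon.mk'
  let J : Submodule Hᵐᵒᵖ H :=
    { carrier := {x | p x ∈ J'}
      add_mem' := fun hx hy => by
        change p _ ∈ J'
        rw [map_add]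
        exact J'.add_mem hx hy
      zero_mem' := by
        change p _ ∈ J'
        rw [map_zero]
        exact J'.zero_mem
      smul_mem' := fun r x hx => by
        change p (x * r.unop) ∈ J'
        rw [map_mul]
        exact J'.smul_mem (MulOpposite.op (p r.unop)) hx }
  let π : J →ₛₗ[factorMap e] J' :=
    { toFun := fun x => ⟨p x, x.2⟩
      map_add' := fun x y => Subtype.ext (map_add p _ _)
      map_smul' := fun r x => Subtype.ext (map_mul p _ _) }
  have := h.projective_rightIdeal J
  have hmem : ∀ x ∈ TwoSidedIdeal.span {e}, x ∈ J := fun x hx => by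
    change p x ∈ J'
    rw [(mk'_eq_zero_iff e).2 hx]
    exact J'.zero_mem
  refine projective_of_semilinear (factorMap_surjective e) π ?_ ?_
  · rintro ⟨y, hy⟩
    obtain ⟨x, rfl⟩ := RingCon.mk'_surjective _ y
    exact ⟨⟨x, hy⟩, rfl⟩
  · rintro ⟨x, hxJ⟩ hx
    have hx' : x ∈ TwoSidedIdeal.span {e} := (mk'_eq_zero_iff e).1 (congrArg Subtype.val hx)
    clear hx
    rw [mem_span_iff_mem_closure] at hx'
    have hmem' := fun y hy => hmem y ((mem_span_iff_mem_closure e).2 hy)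
    induction hx' using AddSubgroup.closure_induction with
    | mem y hy =>
      obtain ⟨a, b, rfl⟩ := hy
      -- Idempotence gives `a e b = (a e)(e b)`, with `a e` in `HeH ⊆ J` and `e b` in `HeH`.
      have hz : a * e ∈ J := hmem _ (TwoSidedIdeal.mul_mem_left _ _ _ (self_mem_span e))
      refine Submodule.subset_span ⟨MulOpposite.op (e * b), ⟨a * e, hz⟩,
        (factorMap_eq_zero_iff e).2 (TwoSidedIdeal.mul_mem_right _ _ _ (self_mem_span e)),
        Subtype.ext ?_⟩
      change a * e * b = a * e * (e * b)
      rw [← mul_assoc, mul_assoc a e e, he.eq]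
    | zero => exact zero_mem _
    | add y z hy hz hy' hz' => exact add_mem (hy' (hmem' y hy)) (hz' (hmem' z hz))
    | neg y hy hy' => exact neg_mem (hy' (hmem' y hy))

end FactorAlgebra

/-! ### The idempotent of a basic projective module -/

section Corner

variable {k : Type v} [Field k] {H : Type u} [Ring H] [Algebra k H] {e : H}

/-- The endomorphism algebra of a module isomorphic to `eH` is `eHe`. -/
lemma nonempty_end_equiv_corner (he : IsIdempotentElem e) (P : ModuleCat.{u} Hᵐᵒᵖ)
    (ψ : rightIdeal e ≃ₗ[Hᵐᵒᵖ] P) : Nonempty (End P ≃ₐ[k] he.Corner) := by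
  -- Transported to `eH`, an endomorphism is left multiplication by its value at the generator `e`.
  let c : End P → H := fun g => (ψ.symm (g.hom (ψ (rightIdealGen e))) : rightIdeal e)
  have hge : MulOpposite.op e • rightIdealGen e = rightIdealGen e := Subtype.ext he
  have hc : ∀ (g : End P) (y : rightIdeal e), (ψ.symm (g.hom (ψ y)) : H) = c g * y := by
    intro g y
    conv_lhs => rw [← op_smul_rightIdealGen he y]
    rw [map_smul, map_smul, map_smul]
    rfl
  have hcm : ∀ g : End P, c g ∈ Subsemigroup.corner e := fun g =>
    (Subsemigroup.mem_corner_iff he).2 ⟨idempotent_mul_rightIdeal he _, by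
      refine (hc g (rightIdealGen e)).symm.trans rfl⟩
  let F : End P →ₐ[k] he.Corner := AlgHom.ofLinearMap
    { toFun := fun g => ⟨c g, hcm g⟩
      map_add' := fun f g => Subtype.ext (by
        simp only [c]
        change ((ψ.symm (f.hom _ + g.hom _) : rightIdeal e) : H) = _
        rw [map_add]
        rfl)
      map_smul' := fun r g => Subtype.ext (by
        simp only [c]
        change ((ψ.symm (algebraMap k Hᵐᵒᵖ r • g.hom _) : rightIdeal e) : H) = _
        rw [map_smul]
        exact (Algebra.commutes r _).symm.trans (Algebra.smul_def _ _).symm) }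
    (Subtype.ext (congrArg (fun y : rightIdeal e => (y : H))
      (ψ.symm_apply_apply (rightIdealGen e))))
    (fun f g => Subtype.ext (by
      change c (f * g) = c f * c g
      rw [← hc]
      simp [c]))
  refine ⟨AlgEquiv.ofBijective F ⟨fun f g h => ?_, fun x => ?_⟩⟩
  · have h' : c f = c g := congrArg (fun x : he.Corner => x.1) h
    refine ModuleCat.hom_ext (LinearMap.ext fun x => ψ.symm.injective (Subtype.ext ?_))
    obtain ⟨y, rfl⟩ := ψ.surjective x
    rw [hc, hc, h']
  · have hx := (Subsemigroup.mem_corner_iff he).1 x.2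
    let m : rightIdeal e →ₗ[Hᵐᵒᵖ] rightIdeal e :=
      { toFun := fun y => ⟨x.1 * y, by rw [← hx.1, mul_assoc]; exact mul_mem_rightIdeal _⟩
        map_add' := fun y z => Subtype.ext (mul_add _ _ _)
        map_smul' := fun r y => Subtype.ext (mul_assoc _ _ _).symm }
    refine ⟨ModuleCat.ofHom (ψ.toLinearMap ∘ₗ m ∘ₗ ψ.symm.toLinearMap), Subtype.ext ?_⟩
    change c _ = x.1
    simp [c, m, rightIdealGen, hx.2]

end Corner

section ExistsIdempotent

variable {H : Type u} [Ring H]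

lemma exists_hom_to_simple (S : ModuleCat.{u} Hᵐᵒᵖ) (hS : IsSimpleModule Hᵐᵒᵖ S) :
    ∃ f : H →ₗ[Hᵐᵒᵖ] S, f ≠ 0 := by
  have := IsSimpleModule.nontrivial Hᵐᵒᵖ S
  obtain ⟨s, hs⟩ := exists_ne (0 : S)
  refine ⟨LinearMap.toSpanSingleton Hᵐᵒᵖ S s ∘ₗ (regularEquiv H).toLinearMap, fun h => hs ?_⟩
  simpa [regularEquiv] using LinearMap.congr_fun h 1

/-- A basic finitely generated projective module over an artinian ring is isomorphic to `eH` for an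
idempotent `e`. -/
theorem exists_idempotent [IsArtinianRing Hᵐᵒᵖ] (P : Type u) [AddCommGroup P] [Module Hᵐᵒᵖ P]
    [Module.Finite Hᵐᵒᵖ P] [Module.Projective Hᵐᵒᵖ P] (hP : IsBasic Hᵐᵒᵖ P) :
    ∃ e : H, IsIdempotentElem e ∧ Nonempty (rightIdeal e ≃ₗ[Hᵐᵒᵖ] P) := by
  obtain ⟨g, hg⟩ := exists_surjective_of_basic P
    (fun N _ _ hN i r h => hP.false_of_retract hN i r h) H
    (fun S hS _ => exists_hom_to_simple S hS)
  obtain ⟨s, hs⟩ := Module.projective_lifting_property g LinearMap.id hg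
  replace hs : ∀ x, g (s x) = x := LinearMap.congr_fun hs
  -- The idempotent endomorphism `s ∘ g` of the right module `H` is left multiplication by its value
  -- at `1`, which is the required `e`.
  have hs1 : ∀ x : H, s (g x) = s (g 1) * x := fun x => by
    have : x = MulOpposite.op x • (1 : H) := (one_mul x).symm
    conv_lhs => rw [this, map_smul, map_smul]
    rfl
  have hr : LinearMap.range s = rightIdeal (s (g 1)) := by
    apply le_antisymm
    · rintro _ ⟨x, rfl⟩
      rw [← hs x, hs1 (s x)]
      exact mul_mem_rightIdeal (s x)
    · rw [rightIdeal, Submodule.span_le]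
      rintro _ rfl
      exact ⟨g 1, rfl⟩
  refine ⟨s (g 1), ?_, ⟨?_⟩⟩
  · rw [IsIdempotentElem, ← hs1, hs]
  · rw [← hr]
    exact (LinearEquiv.ofInjective s (Function.LeftInverse.injective hs)).symm

end ExistsIdempotent

/-! ### τ-rigidity and self-extensions -/

section TauRigid

variable {k : Type v} [Field k] {H : Type u} [Ring H] [Algebra k H]

/-- If `T` is τ-rigid with minimal presentation `Q₁ → Q₀ → T → 0`, then every morphism `Q₁ → T`
factors through `Q₀`. -/
lemma exists_factor_of_forall_tau {Q₁ Q₀ T : ModuleCat.{u} Hᵐᵒᵖ} (f : Q₁ ⟶ Q₀)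
    [Module.Finite Hᵐᵒᵖ Q₁] [Module.Projective Hᵐᵒᵖ Q₁]
    (hg : ∀ g : T →ₗ[Hᵐᵒᵖ] tau k H f, g = 0) (h : Q₁ ⟶ T) : ∃ h' : Q₀ ⟶ T, f ≫ h' = h := by
  let F : (Q₀ ⟶ T) →ₗ[k] (Q₁ ⟶ T) := Linear.leftComp k T f
  suffices LinearMap.range F = ⊤ by
    have hh : h ∈ LinearMap.range F := this ▸ Submodule.mem_top
    exact hh
  by_contra hne
  -- A non-zero linear form on `Hom(Q₁, T)` vanishing on the maps that factor through `f`. Under the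
  -- duality between `Hom(Q₁, T)` and `Hom(T, ν Q₁)` it becomes `g₀`, and the vanishing says that
  -- `g₀` takes values in `τ T`; hence `g₀ = 0`.
  obtain ⟨φ, hφ, hφF⟩ := Submodule.exists_le_ker_of_lt_top _ (lt_top_iff_ne_top.2 hne)
  let r (t : T) (α : Q₁ →ₗ[Hᵐᵒᵖ] H) : Q₁ ⟶ T :=
    ModuleCat.ofHom (LinearMap.toSpanSingleton Hᵐᵒᵖ T t ∘ₗ (regularEquiv H).toLinearMap ∘ₗ α)
  have hr : ∀ t α x, (r t α).hom x = MulOpposite.op (α x) • t := fun _ _ _ => rfl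
  let g₀ : T →ₗ[Hᵐᵒᵖ] Nakayama k H Q₁ :=
    { toFun := fun t =>
        { toFun := fun α => φ (r t α)
          map_add' := fun α β => by
            rw [← map_add]
            congr 1
            ext x
            simp [hr, add_smul]
          map_smul' := fun c α => by
            rw [RingHom.id_apply, ← map_smul]
            congr 1
            ext x
            change _ = algebraMap k Hᵐᵒᵖ c • (r t α).hom x
            rw [hr, hr, LinearMap.smul_apply, MulOpposite.op_smul, Algebra.smul_def, mul_smul] }
      map_add' := fun t t' => LinearMap.ext fun α => by
        change φ (r (t + t') α) = φ (r t α) + φ (r t' α)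
        rw [← map_add]
        congr 1
        ext x
        simp [hr]
      map_smul' := fun a t => LinearMap.ext fun α => by
        change φ (r (a • t) α) = φ (r t (a.unop • α))
        congr 1
        ext x
        rw [hr, hr, ← mul_smul]
        rfl }
  have hg₀ : ∀ t, g₀ t ∈ tau k H f := fun t => LinearMap.ext fun α => by
    change φ (r t (α.comp f.hom)) = 0
    refine hφF ⟨ModuleCat.ofHom (LinearMap.toSpanSingleton Hᵐᵒᵖ T t ∘ₗ
      (regularEquiv H).toLinearMap ∘ₗ α), rfl⟩
  have hzero : ∀ t α, φ (r t α) = 0 := fun t α =>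
    LinearMap.congr_fun (congrArg Subtype.val (LinearMap.congr_fun (hg (g₀.codRestrict _ hg₀)) t)) α
  apply hφ
  ext h
  -- By a dual basis of the projective module `Q₁`, every map `Q₁ → T` is a sum of maps `r t α`, on
  -- which `φ` vanishes.
  obtain ⟨n, p, hp⟩ := Module.Finite.exists_fin' Hᵐᵒᵖ Q₁
  obtain ⟨s, hs⟩ := Module.projective_lifting_property p LinearMap.id hp
  have : h = ∑ i, r (h.hom (p (Pi.single i 1)))
      ((regularEquiv H).symm.toLinearMap ∘ₗ LinearMap.proj i ∘ₗ s) := by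
    ext x
    rw [ModuleCat.hom_sum, LinearMap.sum_apply]
    have hx : x = p (∑ i, (s x) i • Pi.single i 1) := by
      conv_lhs => rw [← LinearMap.id_apply (R := Hᵐᵒᵖ) x, ← hs, LinearMap.comp_apply]
      congr 1
      ext i
      simp [Finset.sum_apply, Pi.single_apply]
    conv_lhs => rw [hx, map_sum, map_sum]
    refine Finset.sum_congr rfl fun i _ => ?_
    rw [map_smul, map_smul]
    rfl
  rw [this, map_sum]
  simp [hzero]

end TauRigid

section Ext

/-- The image of `f` is projective, so `ker f` is a direct summand of `Q₁`; being superfluous by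
minimality, it is zero. -/
lemma IsMinimalProjectivePresentation.injective {H : Type u} [Ring H]
    {Q₁ Q₀ T : ModuleCat.{u} Hᵐᵒᵖ}
    {f : Q₁ ⟶ Q₀} {p : Q₀ ⟶ T} (h : IsMinimalProjectivePresentation f p)
    (hs : SubmodulesProjective Hᵐᵒᵖ Q₀) : Function.Injective f.hom := by
  have := hs (LinearMap.range f.hom)
  obtain ⟨s, hs⟩ := Module.projective_lifting_property f.hom.rangeRestrict LinearMap.id
    f.hom.surjective_rangeRestrict
  replace hs : ∀ x, f.hom.rangeRestrict (s x) = x := LinearMap.congr_fun hs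
  have hc := isCompl_range_ker_of_retract s _ hs
  rw [LinearMap.ker_rangeRestrict] at hc
  have := h.minimal₁ _ (by rw [sup_comm]; exact hc.sup_eq_top)
  rw [this] at hc
  rw [← LinearMap.ker_eq_bot]
  simpa using hc.disjoint

/-- Vanishing of `Ext¹` from lifting along a monomorphism of a projective presentation. -/
lemma ext_one_eq_zero_of_forall_factor {C : Type*} [Category C] [Abelian C] [HasExt.{w} C]
    {S : ShortComplex C} (hS : S.ShortExact) [Projective S.X₂] (Y : C)
    (h : ∀ g : S.X₁ ⟶ Y, ∃ g' : S.X₂ ⟶ Y, S.f ≫ g' = g) (x : Abelian.Ext S.X₃ Y 1) : x = 0 := by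
  obtain ⟨x₁, rfl⟩ := Abelian.Ext.contravariant_sequence_exact₃ hS Y x
    (Abelian.Ext.eq_zero_of_projective _) (n₀ := 0) rfl
  obtain ⟨g, rfl⟩ := (Abelian.Ext.mk₀_bijective _ _).2 x₁
  obtain ⟨g', rfl⟩ := h g
  rw [← Abelian.Ext.mk₀_comp_mk₀, hS.extClass_comp_assoc]

end Ext

/-! ### `T` is tilting over `H/HeH` -/

section Tilting

variable {k : Type v} [Field k] {H : Type u} [Ring H] [Algebra k H]

lemma IsMinimalProjectivePresentation.shortExact {Q₁ Q₀ T : ModuleCat.{u} Hᵐᵒᵖ}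
    {f : Q₁ ⟶ Q₀} {p : Q₀ ⟶ T} (h : IsMinimalProjectivePresentation f p)
    (hH : IsHereditaryAlgebra k H) :
    (ShortComplex.mk f p (ModuleCat.hom_ext h.exact.linearMap_comp_eq_zero)).ShortExact := by
  have := h.finite₀
  have := h.projective₀
  exact
    { exact := (ShortComplex.ShortExact.moduleCat_exact_iff_function_exact _).2 h.exact
      mono_f := (ModuleCat.mono_iff_injective _).2 (h.injective (hH.submodulesProjective _))
      epi_g := (ModuleCat.epi_iff_surjective _).2 h.surjective }

/-- A τ-rigid module over a hereditary algebra has no self-extensions. -/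
lemma IsTauRigid.ext_eq_zero {T : ModuleCat.{u} Hᵐᵒᵖ} (hH : IsHereditaryAlgebra k H)
    (h : IsTauRigid k H T) (x : Abelian.Ext T T 1) : x = 0 := by
  obtain ⟨Q₁, Q₀, f, p, hfp, hg⟩ := h
  have := hfp.finite₁
  have := hfp.projective₁
  have : Projective Q₀ := (IsProjective.iff_projective _).1 hfp.projective₀
  exact ext_one_eq_zero_of_forall_factor (hfp.shortExact hH) T
    (fun g => exists_factor_of_forall_tau (k := k) f hg g) x

section Restrict

variable {R R' : Type u} [Ring R] [Ring R'] {φ : R →+* R'} (hφ : Function.Surjective φ)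
  {T : ModuleCat.{u} R} {T' : ModuleCat.{u} R'} (l : T →ₛₗ[φ] T') (hl : Function.Bijective l)

/-- A bijective semilinear map, as an isomorphism from the restriction of scalars. -/
def restrictIso : (ModuleCat.restrictScalars φ).obj T' ≅ T :=
  (LinearEquiv.ofBijective (M₂ := (ModuleCat.restrictScalars φ).obj T')
    ({ l with map_smul' := fun r x => l.map_smulₛₗ r x } :
      T →ₗ[R] (ModuleCat.restrictScalars φ).obj T') hl).toModuleIso.symm

include hφ hl in
/-- Self-extensions over a factor ring vanish if they vanish over the ring. -/
lemma ext_eq_zero_of_surjective [IsNoetherianRing R'] [Module.Finite R' T']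
    (h : ∀ x : Abelian.Ext T T 1, x = 0) (x : Abelian.Ext T' T' 1) : x = 0 := by
  have h' : ∀ x : Abelian.Ext ((ModuleCat.restrictScalars φ).obj T')
      ((ModuleCat.restrictScalars φ).obj T') 1, x = 0 := fun x => by
    let e := restrictIso l hl
    have : x = (Abelian.Ext.mk₀ e.hom).comp (((Abelian.Ext.mk₀ e.inv).comp
        (x.comp (Abelian.Ext.mk₀ e.hom) (add_zero 1)) (zero_add 1)).comp
        (Abelian.Ext.mk₀ e.inv) (add_zero 1)) (zero_add 1) := by
      simp
    rw [this, h ((Abelian.Ext.mk₀ e.inv).comp _ _)]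
    simp
  -- A free presentation over `R'` remains exact over `R`, though its middle term need not be
  -- projective there. Vanishing of `Ext¹` over `R` still extends `g` to the middle term, and the
  -- extension is `R'`-linear because `φ` is surjective.
  obtain ⟨n, p, hp⟩ := Module.Finite.exists_fin' R' T'
  have hS := LinearMap.shortExact_shortComplexKer hp
  have : Projective p.shortComplexKer.X₂ :=
    (IsProjective.iff_projective _).1 (inferInstanceAs (Module.Projective R' (Fin n → R')))
  have hS' : (p.shortComplexKer.map (ModuleCat.restrictScalars φ)).ShortExact :=
    ModuleCat.shortComplex_shortExact _
      ((ShortComplex.ShortExact.moduleCat_exact_iff_function_exact p.shortComplexKer).1 hS.exact)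
      hS.moduleCat_injective_f hS.moduleCat_surjective_g
  refine ext_one_eq_zero_of_forall_factor hS T' (fun g => ?_) x
  obtain ⟨y, hy⟩ := Abelian.Ext.contravariant_sequence_exact₁
    hS' ((ModuleCat.restrictScalars φ).obj T')
    (Abelian.Ext.mk₀ ((ModuleCat.restrictScalars φ).map g)) (add_zero 1) (h' _)
  obtain ⟨g', rfl⟩ := (Abelian.Ext.mk₀_bijective _ _).2 y
  rw [Abelian.Ext.mk₀_comp_mk₀] at hy
  have hy' := (Abelian.Ext.mk₀_bijective _ _).1 hy
  let g'' : p.shortComplexKer.X₂ ⟶ T' := ModuleCat.ofHom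
    { toFun := fun y => g'.hom y
      map_add' := fun y z => g'.hom.map_add y z
      map_smul' := fun r y => by
        obtain ⟨r, rfl⟩ := hφ r
        exact g'.hom.map_smul r y }
  exact ⟨g'', ModuleCat.hom_ext (LinearMap.ext fun y =>
    LinearMap.congr_fun (congrArg ModuleCat.Hom.hom hy') y)⟩

variable {k : Type v} [Field k] [Algebra k R] [Algebra k R']

include hφ hl in
/-- A bijective semilinear map over a surjective algebra homomorphism identifies the endomorphism
algebras. -/
lemma nonempty_end_equiv_of_bijective (hk : ∀ c, φ (algebraMap k R c) = algebraMap k R' c) :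
    Nonempty (End T ≃ₐ[k] End T') := by
  let el := AddEquiv.ofBijective l.toAddMonoidHom hl
  have hel : ∀ (r : R) x, el (r • x) = φ r • el x := fun r x => l.map_smulₛₗ r x
  have hel' : ∀ (r : R) x, el.symm (φ r • x) = r • el.symm x := fun r x => by
    rw [el.symm_apply_eq, hel, el.apply_symm_apply]
  let F : End T →ₐ[k] End T' := AlgHom.ofLinearMap
    { toFun := fun g => ModuleCat.ofHom
        { toFun := fun x => el (g.hom (el.symm x))
          map_add' := fun x y => by simp
          map_smul' := fun r x => by
            obtain ⟨r, rfl⟩ := hφ r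
            rw [hel', map_smul, hel, RingHom.id_apply] }
      map_add' := fun f g => ModuleCat.hom_ext (LinearMap.ext fun x => el.map_add _ _)
      map_smul' := fun c g => ModuleCat.hom_ext (LinearMap.ext fun x => by
        change el (algebraMap k R c • g.hom (el.symm x)) =
          algebraMap k R' c • el (g.hom (el.symm x))
        rw [hel, hk]) }
    (ModuleCat.hom_ext (LinearMap.ext fun x => el.apply_symm_apply x))
    (fun f g => ModuleCat.hom_ext (LinearMap.ext fun x => by
      change el (f.hom (g.hom (el.symm x))) = el (f.hom (el.symm (el (g.hom (el.symm x)))))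
      rw [el.symm_apply_apply]))
  have hF : ∀ g x, (F g).hom x = el (g.hom (el.symm x)) := fun _ _ => rfl
  refine ⟨AlgEquiv.ofBijective F ⟨fun f g h => ?_, fun g => ?_⟩⟩
  · refine ModuleCat.hom_ext (LinearMap.ext fun x => el.injective ?_)
    rw [← el.symm_apply_apply x, ← hF, ← hF, h]
  · refine ⟨ModuleCat.ofHom
      { toFun := fun x => el.symm (g.hom (el x))
        map_add' := fun x y => by simp
        map_smul' := fun r x => by rw [hel, map_smul, hel', RingHom.id_apply] }, ?_⟩
    refine ModuleCat.hom_ext (LinearMap.ext fun x => ?_)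
    rw [hF]
    change el (el.symm (g.hom (el (el.symm x)))) = g.hom x
    simp

end Restrict

lemma IsHereditaryAlgebra.hasProjectiveDimensionLE_one (hH : IsHereditaryAlgebra k H)
    (T : ModuleCat.{u} Hᵐᵒᵖ) [Module.Finite Hᵐᵒᵖ T] : HasProjectiveDimensionLE T 1 := by
  obtain ⟨n, p, hp⟩ := Module.Finite.exists_fin' Hᵐᵒᵖ T
  have hS := LinearMap.shortExact_shortComplexKer hp
  have : Projective p.shortComplexKer.X₂ :=
    (IsProjective.iff_projective _).1 (inferInstanceAs (Module.Projective Hᵐᵒᵖ (Fin n → Hᵐᵒᵖ)))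
  have : Projective p.shortComplexKer.X₁ :=
    (IsProjective.iff_projective _).1 (hH.submodulesProjective (Fin n → Hᵐᵒᵖ) _)
  have h₁ : HasProjectiveDimensionLT p.shortComplexKer.X₁ 1 :=
    projective_iff_hasProjectiveDimensionLT_one.1 ‹_›
  have h₂ : HasProjectiveDimensionLT p.shortComplexKer.X₂ 1 :=
    projective_iff_hasProjectiveDimensionLT_one.1 ‹_›
  exact hS.hasProjectiveDimensionLT_X₃ 1 h₁ (hasProjectiveDimensionLT_of_ge _ 1 2 (by simp))

/-- For a support τ-tilting pair `(T, eH)` over a hereditary algebra `H`, the module `T` is a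
tilting module over `H/HeH`. -/
theorem exists_isTilting {T P : ModuleCat.{u} Hᵐᵒᵖ} (hH : IsHereditaryAlgebra k H)
    (hTP : IsSupportTauTiltingPair k H T P) {e : H} (he : IsIdempotentElem e)
    (ψ : rightIdeal e ≃ₗ[Hᵐᵒᵖ] P) :
    ∃ (T' : ModuleCat.{u} (QuotientByIdempotent e)ᵐᵒᵖ) (l : T →ₛₗ[factorMap e] T'),
      Function.Bijective l ∧ IsTilting (QuotientByIdempotent e) T' := by
  have hH' := hH.quotientByIdempotent he
  have := hH.isArtinianRing
  have := hH'.isArtinianRing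
  have := hTP.finite_left
  have := hTP.finite_right
  have := hTP.projective_right
  have hT : ∀ x : T, MulOpposite.op e • x = 0 :=
    (forall_rightIdeal_hom_eq_zero_iff he T).1 fun f => by
      have := hTP.hom_eq_zero (f ∘ₗ ψ.symm.toLinearMap)
      ext x
      simpa using LinearMap.congr_fun this (ψ x)
  have hT' := (forall_factorMap_smul_iff e T).2 hT
  let := moduleOfSurjective (factorMap e) (factorMap_surjective e) T hT'
  let T' : ModuleCat.{u} (QuotientByIdempotent e)ᵐᵒᵖ := ModuleCat.of _ T
  let l : T →ₛₗ[factorMap e] T' :=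
    { toFun := fun x => x
      map_add' := fun _ _ => rfl
      map_smul' := fun r x =>
        (moduleOfSurjective_smul (factorMap e) (factorMap_surjective e) T hT' r x).symm }
  have hl : Function.Bijective l := Function.bijective_id
  have hfin : Module.Finite (QuotientByIdempotent e)ᵐᵒᵖ T' := Module.Finite.of_surjective l hl.2
  refine ⟨T', l, hl, hfin, hH'.hasProjectiveDimensionLE_one T', ?_, ?_⟩
  · exact ext_eq_zero_of_surjective (factorMap_surjective e) l hl (hTP.tauRigid.ext_eq_zero hH)
  · rw [← numSummands_eq_of_bijective l hl]
    -- Finiteness of `|P|` allows cancelling it in `ℕ∞` from `|T| + |P| = |H| = |H/HeH| + |P|`.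
    have hP : numSummands Hᵐᵒᵖ P ≠ ⊤ := by
      rw [numSummands_eq_card_simpleQuotient]
      have := finite_simpleQuotient Hᵐᵒᵖ P
      exact (ENat.card_lt_top_of_finite).ne
    refine ENat.add_left_injective_of_ne_top hP (hTP.numSummands_add.trans ?_)
    rw [numSummands_eq_card_simpleQuotient, numSummands_eq_card_simpleQuotient,
      numSummands_eq_card_simpleQuotient]
    refine (card_simpleQuotient_add (factorMap e) (factorMap_surjective e) P H
      (QuotientByIdempotent e) exists_hom_to_simple exists_hom_to_simple fun S _ => ?_).symm
    rw [forall_factorMap_smul_iff, ← forall_rightIdeal_hom_eq_zero_iff he]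
    constructor
    · intro h f
      ext x
      simpa using LinearMap.congr_fun (h (f ∘ₗ ψ.symm.toLinearMap)) (ψ x)
    · intro h f
      ext x
      simpa using LinearMap.congr_fun (h (f ∘ₗ ψ.toLinearMap)) (ψ.symm x)

end Tilting

section Main

variable {k : Type v} [Field k] {H : Type u} [Ring H] [Algebra k H]

theorem exists_idempotent_isTilting {T P : ModuleCat.{u} Hᵐᵒᵖ} (hH : IsHereditaryAlgebra k H)
    (hTP : IsSupportTauTiltingPair k H T P) (hT : IsBasic Hᵐᵒᵖ T) (hP : IsBasic Hᵐᵒᵖ P) :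
    IsTiltedAlgebra k (End T) ∧
    ∃ (e : H) (he : IsIdempotentElem e),
      Nonempty (rightIdeal e ≃ₗ[Hᵐᵒᵖ] P) ∧
      Nonempty (End P ≃ₐ[k] he.Corner) ∧
      IsHereditaryAlgebra k (QuotientByIdempotent e) ∧
      ∃ T' : ModuleCat.{u} (QuotientByIdempotent e)ᵐᵒᵖ,
        Nonempty (inflate e T' ≅ T) ∧ IsTilting (QuotientByIdempotent e) T' := by
  have := hH.isArtinianRing
  have := hTP.finite_right
  have := hTP.projective_right
  obtain ⟨e, he, ⟨ψ⟩⟩ := exists_idempotent P hP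
  obtain ⟨T', l, hl, hT'⟩ := exists_isTilting hH hTP he ψ
  have hH' := hH.quotientByIdempotent he
  exact ⟨⟨_, _, _, T', hH', hT.of_bijective l hl, hT',
      nonempty_end_equiv_of_bijective (factorMap_surjective e) l hl fun _ => rfl⟩,
    e, he, ⟨ψ⟩, nonempty_end_equiv_corner he P ψ, hH', T', ⟨restrictIso l hl⟩, hT'⟩

end Main

/-! ### Endomorphisms of a biproduct as triangular matrices -/

section TriangularEnd

variable {k : Type*} [CommRing k] {D : Type*} [Category D] [Preadditive D] [Linear k D]
  {B M C : Type*} [Ring B] [Ring C] [AddCommGroup M] [Algebra k B] [Algebra k C] [Module k M]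
  [Module C M] [Module Bᵐᵒᵖ M] [SMulCommClass C Bᵐᵒᵖ M] [IsScalarTower k C M]
  [IsScalarTower k Bᵐᵒᵖ M]

/-- The endomorphism algebra of a biproduct `U ⊕ V` with `Hom(V, U) = 0` is an algebra of lower
triangular matrices. -/
lemma nonempty_end_equiv_triangular {U V : D} (b : Limits.BinaryBicone U V)
    (hb : b.fst ≫ b.inl + b.snd ≫ b.inr = 𝟙 b.pt) (hVU : ∀ f : V ⟶ U, f = 0)
    (α : B ≃ₐ[k] End U) (γ : C ≃ₐ[k] End V) (μ : M ≃ₗ[k] (U ⟶ V))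
    (hα : ∀ (x : B) (m : M), μ (MulOpposite.op x • m) = (α x : U ⟶ U) ≫ μ m)
    (hγ : ∀ (x : C) (m : M), μ (x • m) = μ m ≫ (γ x : V ⟶ V)) :
    Nonempty (TriangularMatrix B M C ≃ₐ[k] End b.pt) := by
  -- Endomorphisms are viewed as arrows through `a` and `c`, so that products in `End` turn into
  -- composites in reversed order.
  obtain ⟨a, ha⟩ : ∃ a : B → (U ⟶ U), ∀ x, a x = (α x : U ⟶ U) := ⟨fun x => α x, fun _ => rfl⟩
  obtain ⟨c, hc⟩ : ∃ c : C → (V ⟶ V), ∀ x, c x = (γ x : V ⟶ V) := ⟨fun x => γ x, fun _ => rfl⟩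
  simp only [← ha, ← hc] at hα hγ
  have ham : ∀ x y, a (x * y) = a y ≫ a x := fun x y => by
    simp only [ha]; exact map_mul α x y
  have hcm : ∀ x y, c (x * y) = c y ≫ c x := fun x y => by
    simp only [hc]; exact map_mul γ x y
  have haa : ∀ x y, a (x + y) = a x + a y := fun x y => by
    simp only [ha]; exact map_add α x y
  have hca : ∀ x y, c (x + y) = c x + c y := fun x y => by
    simp only [hc]; exact map_add γ x y
  have ha1 : a 1 = 𝟙 U := (ha 1).trans (map_one α)
  have hc1 : c 1 = 𝟙 V := (hc 1).trans (map_one γ)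
  have has : ∀ (r : k) x, a (r • x) = r • a x := fun r x => by
    simp only [ha]; exact map_smul α r x
  have hcs : ∀ (r : k) x, c (r • x) = r • c x := fun r x => by
    simp only [hc]; exact map_smul γ r x
  have hai : ∀ x y, a x = a y → x = y := fun x y h => α.injective (by
    rw [ha, ha] at h; exact h)
  have hci : ∀ x y, c x = c y → x = y := fun x y h => γ.injective (by
    rw [hc, hc] at h; exact h)
  have hasurj : ∀ g, ∃ x, a x = g := fun g => ⟨α.symm g, (ha _).trans (α.apply_symm_apply g)⟩
  have hcsurj : ∀ g, ∃ x, c x = g := fun g => ⟨γ.symm g, (hc _).trans (γ.apply_symm_apply g)⟩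
  clear ha hc α γ
  let F₀ : TriangularMatrix B M C → (b.pt ⟶ b.pt) := fun x =>
    b.fst ≫ a x.b ≫ b.inl + b.fst ≫ μ x.m ≫ b.inr + b.snd ≫ c x.c ≫ b.inr
  let F : TriangularMatrix B M C →ₐ[k] End b.pt := AlgHom.ofLinearMap
    { toFun := F₀
      map_add' := fun x y => by
        change F₀ (x + y) = F₀ x + F₀ y
        simp only [F₀, TriangularMatrix.add_b, TriangularMatrix.add_m, TriangularMatrix.add_c, haa,
          hca, map_add, Preadditive.add_comp, Preadditive.comp_add]
        abel
      map_smul' := fun r x => by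
        change F₀ (r • x) = r • F₀ x
        simp [F₀, has, hcs] }
    (by
      change F₀ 1 = 𝟙 _
      simpa [F₀, ha1, hc1] using hb)
    (fun x y => by
      change F₀ (x * y) = F₀ y ≫ F₀ x
      simp only [F₀, TriangularMatrix.mul_b, TriangularMatrix.mul_m, TriangularMatrix.mul_c, ham,
        hcm, map_add, hα, hγ, Preadditive.add_comp, Preadditive.comp_add, Category.assoc,
        Limits.BinaryBicone.inl_fst_assoc, Limits.BinaryBicone.inr_snd_assoc,
        Limits.BinaryBicone.inl_snd_assoc, Limits.BinaryBicone.inr_fst_assoc,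
        Limits.zero_comp, Limits.comp_zero]
      abel)
  refine ⟨AlgEquiv.ofBijective F ⟨fun x y h => ?_, fun g => ?_⟩⟩
  · have h' : F₀ x = F₀ y := h
    have h1 := congrArg (fun g => b.inl ≫ g ≫ b.fst) h'
    have h2 := congrArg (fun g => b.inl ≫ g ≫ b.snd) h'
    have h3 := congrArg (fun g => b.inr ≫ g ≫ b.snd) h'
    simp only [F₀, Preadditive.add_comp, Preadditive.comp_add, Category.assoc,
      Limits.BinaryBicone.inl_fst_assoc, Limits.BinaryBicone.inr_snd_assoc,
      Limits.BinaryBicone.inl_snd_assoc, Limits.BinaryBicone.inr_fst_assoc,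
      Limits.BinaryBicone.inl_fst, Limits.BinaryBicone.inr_snd,
      Limits.BinaryBicone.inl_snd, Limits.BinaryBicone.inr_fst,
      Limits.zero_comp, Limits.comp_zero, Category.comp_id, add_zero, zero_add] at h1 h2 h3
    exact TriangularMatrix.ext (hai _ _ h1) (μ.injective h2) (hci _ _ h3)
  · obtain ⟨g', hg'⟩ : ∃ g' : b.pt ⟶ b.pt, g' = g := ⟨g, rfl⟩
    obtain ⟨x, hx⟩ := hasurj (b.inl ≫ g' ≫ b.fst)
    obtain ⟨z, hz⟩ := hcsurj (b.inr ≫ g' ≫ b.snd)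
    refine ⟨⟨x, μ.symm (b.inl ≫ g' ≫ b.snd), z⟩, Eq.trans ?_ hg'⟩
    change F₀ _ = g'
    simp only [F₀, LinearEquiv.apply_symm_apply, hx, hz]
    -- Of the four blocks of `g'`, the one from `V` to `U` vanishes; the other three are the entries
    -- of the matrix.
    have h0 := hVU (b.inr ≫ g' ≫ b.fst)
    have : g' = (b.fst ≫ b.inl + b.snd ≫ b.inr) ≫ g' ≫ (b.fst ≫ b.inl + b.snd ≫ b.inr) := by
      rw [hb, Category.comp_id, Category.id_comp]
    conv_rhs => rw [this]
    have h0' : b.inr ≫ g' ≫ b.fst ≫ b.inl = 0 := by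
      rw [← Category.assoc g', ← Category.assoc, h0, Limits.zero_comp]
    simp only [Preadditive.add_comp, Preadditive.comp_add, Category.assoc, h0', Limits.comp_zero]
    abel

end TriangularEnd

/-! ### Two-term complexes -/

section TwoTerm

open Limits HomologicalComplex

variable {C : Type*} [Category C] [Abelian C]

lemma up_rel_neg_one_zero : (ComplexShape.up ℤ).Rel (-1) 0 := by simp

lemma neg_one_ne_zero_int : (-1 : ℤ) ≠ 0 := by simp

/-- The complex `A --f--> B` with `B` in degree `0`. -/
abbrev twoTerm {A B : C} (f : A ⟶ B) : CochainComplex C ℤ := double f up_rel_neg_one_zero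

section Decomposition

variable {A B : C} (f : A ⟶ B) (P : C)

/-- The projection of `A ⊕ P --(f, 0)--> B` to `A --f--> B`. -/
def twoTermFst : twoTerm (biprod.desc f (0 : P ⟶ B)) ⟶ twoTerm f :=
  mkHomFromDouble _ neg_one_ne_zero_int (biprod.fst ≫ (doubleXIso₀ _ _).inv)
    (doubleXIso₁ _ _ neg_one_ne_zero_int).inv (by
      rw [double_d _ _ neg_one_ne_zero_int]
      ext <;> simp) (fun k _ => by
      rw [double_d_eq_zero₀ _ _ _ _ (by simp), comp_zero])

/-- The projection of `A ⊕ P --(f, 0)--> B` to `P` in degree `-1`. -/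
def twoTermSnd : twoTerm (biprod.desc f (0 : P ⟶ B)) ⟶
    (single C (ComplexShape.up ℤ) (-1)).obj P :=
  mkHomFromDouble _ neg_one_ne_zero_int (biprod.snd ≫ (singleObjXSelf _ _ _).inv) 0
    (by simp) (by simp)

/-- The inclusion of `A --f--> B` in `A ⊕ P --(f, 0)--> B`. -/
def twoTermInl : twoTerm f ⟶ twoTerm (biprod.desc f (0 : P ⟶ B)) :=
  mkHomFromDouble _ neg_one_ne_zero_int (biprod.inl ≫ (doubleXIso₀ _ _).inv)
    (doubleXIso₁ _ _ neg_one_ne_zero_int).inv (by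
      rw [double_d _ _ neg_one_ne_zero_int]
      simp) (fun k _ => by
      rw [double_d_eq_zero₀ _ _ _ _ (by simp), comp_zero])

/-- The inclusion of `P` in degree `-1` in `A ⊕ P --(f, 0)--> B`. -/
def twoTermInr : (single C (ComplexShape.up ℤ) (-1)).obj P ⟶
    twoTerm (biprod.desc f (0 : P ⟶ B)) :=
  mkHomFromSingle (biprod.inr ≫ (doubleXIso₀ _ _).inv) (fun k hk => by
    obtain rfl : k = 0 := by
      simp only [ComplexShape.up_Rel] at hk
      omega
    rw [double_d _ _ neg_one_ne_zero_int]
    simp)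

/-- The decomposition of the complex `A ⊕ P --(f, 0)--> B` as the direct sum of `A --f--> B` and
`P` in degree `-1`. -/
def twoTermBicone : BinaryBicone (twoTerm f) ((single C (ComplexShape.up ℤ) (-1)).obj P) where
  pt := twoTerm (biprod.desc f (0 : P ⟶ B))
  fst := twoTermFst f P
  snd := twoTermSnd f P
  inl := twoTermInl f P
  inr := twoTermInr f P
  inl_fst := by apply from_double_hom_ext <;> simp [twoTermInl, twoTermFst]
  inl_snd := by apply from_double_hom_ext <;> simp [twoTermInl, twoTermSnd]
  inr_fst := by apply from_single_hom_ext; simp [twoTermInr, twoTermFst]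
  inr_snd := by apply from_single_hom_ext; simp [twoTermInr, twoTermSnd]

lemma twoTermBicone_total :
    twoTermFst f P ≫ twoTermInl f P + twoTermSnd f P ≫ twoTermInr f P = 𝟙 _ := by
  refine from_double_hom_ext ?_ ?_
  · rw [add_f_apply, comp_f, comp_f]
    simp only [twoTermFst, twoTermSnd, twoTermInl, twoTermInr, mkHomFromDouble_f₀,
      mkHomFromSingle_f, Category.assoc, Iso.inv_hom_id_assoc, id_f]
    rw [← Preadditive.comp_add, ← Category.assoc biprod.fst, ← Category.assoc biprod.snd,
      ← Preadditive.add_comp, biprod.total, Category.id_comp, Iso.hom_inv_id]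
  · rw [add_f_apply, comp_f, comp_f]
    simp [twoTermFst, twoTermSnd, twoTermInl]

end Decomposition

/-- The augmentation of a two-term resolution. -/
def twoTermAugmentation (S : ShortComplex C) :
    twoTerm S.f ⟶ (single C (ComplexShape.up ℤ) 0).obj S.X₃ :=
  mkHomFromDouble _ (by simp) 0 (S.g ≫ (singleObjXSelf _ _ _).inv) (by simp) (by simp)

/-- In degree `0` the condition is exactness at `S.X₂` with `S.g` an epimorphism, in degree `-1` it
is that `S.f` is a monomorphism, and elsewhere both complexes vanish. -/
lemma quasiIso_twoTermAugmentation {S : ShortComplex C} (hS : S.ShortExact) :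
    QuasiIso (twoTermAugmentation S) where
  quasiIsoAt i := by
    by_cases h0 : i = 0
    · subst h0
      rw [quasiIsoAt_iff' _ (-1) 0 1 (by simp) (by simp), ShortComplex.quasiIso_iff_of_zeros']
      · refine ⟨ShortComplex.exact_of_iso (ShortComplex.isoMk (doubleXIso₀ S.f up_rel_neg_one_zero).symm
          (doubleXIso₁ S.f up_rel_neg_one_zero (by simp)).symm (singleObjXSelf (ComplexShape.up ℤ) 0 S.X₃).symm ?_ ?_)
          hS.exact, ?_⟩
        · simp [double_d, shortComplexFunctor']
        · simp [twoTermAugmentation]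
          exact Iso.inv_hom_id_assoc _ _
        · have := hS.epi_g
          change Epi ((twoTermAugmentation S).f 0)
          simp only [twoTermAugmentation, mkHomFromDouble_f₁]
          infer_instance
      · exact double_d_eq_zero₀ S.f up_rel_neg_one_zero _ _ (by simp)
      · exact single_obj_d (ComplexShape.up ℤ) _ _ _ _
      · exact single_obj_d (ComplexShape.up ℤ) _ _ _ _
    · rw [quasiIsoAt_iff_exactAt' _ _ (exactAt_single_obj _ _ _ _ h0)]
      by_cases h1 : i = -1
      · subst h1
        rw [exactAt_iff' _ (-2) (-1) 0 (by simp) (by simp), ShortComplex.exact_iff_mono]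
        · have := hS.mono_f
          change Mono ((twoTerm S.f).d (-1) 0)
          rw [double_d _ _ (by simp)]
          infer_instance
        · exact double_d_eq_zero₀ S.f up_rel_neg_one_zero _ _ (by simp)
      · exact ExactAt.of_isZero (isZero_double_X _ _ _ h1 h0)

end TwoTerm

section Functoriality

/-- Transport of a binary bicone along isomorphisms. -/
def biconeOfIso {D : Type*} [Category D] [Limits.HasZeroMorphisms D] {U V U' V' : D}
    (b : Limits.BinaryBicone U V) (e : U ≅ U') (e' : V ≅ V') : Limits.BinaryBicone U' V' where
  pt := b.pt
  fst := b.fst ≫ e.hom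
  snd := b.snd ≫ e'.hom
  inl := e.inv ≫ b.inl
  inr := e'.inv ≫ b.inr

/-- A fully faithful linear functor induces isomorphisms of endomorphism algebras. -/
def endAlgEquiv (k : Type*) [CommRing k] {D E : Type*} [Category D] [Category E] [Preadditive D]
    [Preadditive E] [Linear k D] [Linear k E] (F : D ⥤ E) [F.Additive] [F.Linear k] [F.Full]
    [F.Faithful] (X : D) : End X ≃ₐ[k] End (F.obj X) :=
  AlgEquiv.ofBijective (AlgHom.ofLinearMap (F.mapLinearMap k : (X ⟶ X) →ₗ[k] _)
    (F.map_id X) (fun f g => F.map_comp g f)) ⟨F.map_injective, F.map_surjective⟩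

/-- Isomorphic objects have isomorphic endomorphism algebras. -/
def endAlgEquivOfIso (k : Type*) [CommRing k] {D : Type*} [Category D] [Preadditive D]
    [Linear k D] {X Y : D} (e : X ≅ Y) : End X ≃ₐ[k] End Y :=
  AlgEquiv.ofLinearEquiv (Linear.homCongr k e e)
    (by change (e.inv ≫ 𝟙 X) ≫ e.hom = 𝟙 Y; simp)
    (fun x y => by
      let f : X ⟶ X := x
      let g : X ⟶ X := y
      change (e.inv ≫ g ≫ f) ≫ e.hom = ((e.inv ≫ g) ≫ e.hom) ≫ (e.inv ≫ f) ≫ e.hom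
      simp)

end Functoriality

/-! ### The endomorphism algebra in the derived category -/

section Derived

open Limits HomologicalComplex DerivedCategory

variable {C : Type*} [Category C] [Abelian C] [HasDerivedCategory.{w} C]

/-- The class in the derived category of a module in degree `-1` is the shift of its class in
degree `0`. -/
def singleNegOneIso (P : C) : Q.obj ((single C (ComplexShape.up ℤ) (-1)).obj P) ≅
    ((singleFunctor C 0).obj P)⟦((1 : ℕ) : ℤ)⟧ :=
  ((singleFunctorIsoCompQ C (-1)).app P).symm ≪≫
    (((singleFunctors C).shiftIso 1 (-1) 0 (by simp)).app P).symm

/-- The class in the derived category of a two-term resolution. -/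
def twoTermIso {S : ShortComplex C} (hS : S.ShortExact) :
    Q.obj (twoTerm S.f) ≅ (singleFunctor C 0).obj S.X₃ :=
  have := quasiIso_twoTermAugmentation hS
  asIso (Q.map (twoTermAugmentation S)) ≪≫ ((singleFunctorIsoCompQ C 0).app S.X₃).symm

/-- In the derived category, `A ⊕ P --(f, 0)--> B` is the direct sum of `coker f` and `P[1]`, if
`f` is a monomorphism. -/
def derivedBicone {S : ShortComplex C} (hS : S.ShortExact) (P : C) :
    BinaryBicone ((singleFunctor C 0).obj S.X₃) (((singleFunctor C 0).obj P)⟦((1 : ℕ) : ℤ)⟧) :=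
  biconeOfIso (Q.mapBinaryBicone (twoTermBicone S.f P)) (twoTermIso hS) (singleNegOneIso P)

lemma derivedBicone_total {S : ShortComplex C} (hS : S.ShortExact) (P : C) :
    (derivedBicone hS P).fst ≫ (derivedBicone hS P).inl +
      (derivedBicone hS P).snd ≫ (derivedBicone hS P).inr = 𝟙 _ := by
  simp only [derivedBicone, biconeOfIso, Category.assoc, Iso.hom_inv_id_assoc]
  have := congrArg (Q (C := C)).map (twoTermBicone_total S.f P)
  simp only [Functor.map_add, Functor.map_comp] at this
  exact this.trans (Q.map_id _)

/-- The source is concentrated in degree `-1` and the target in degree `0`, and the derived category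
has no non-zero morphisms from a complex in degrees at most `-1` to one in degrees at least `0`. -/
lemma hom_shift_eq_zero (P T : C)
    (f : ((singleFunctor C 0).obj P)⟦((1 : ℕ) : ℤ)⟧ ⟶ (singleFunctor C 0).obj T) : f = 0 := by
  have := subsingleton_hom_of_isStrictlyLE_of_isStrictlyGE
    ((CochainComplex.singleFunctor C (-1)).obj P) ((CochainComplex.singleFunctor C 0).obj T) (-1) 0
    (by simp)
  have h : (singleNegOneIso P).hom ≫ f ≫ ((singleFunctorIsoCompQ C 0).app T).hom = 0 :=
    this.elim _ _
  have h' := (cancel_epi (singleNegOneIso P).hom).1 (h.trans comp_zero.symm)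
  exact (cancel_mono ((singleFunctorIsoCompQ C 0).app T).hom).1 (h'.trans zero_comp.symm)

/-- The off-diagonal entry is `Hom(S.X₃, P[1])`, and the identification of `Ext¹` with it turns
Yoneda products into composites, so the two actions match. The shift is written `((1 : ℕ) : ℤ)` to
agree with `Abelian.Ext.homLinearEquiv`. -/
theorem nonempty_end_equiv_triangular_ext (k : Type*) [Field k] [Linear k C] [HasExt.{v} C]
    {S : ShortComplex C} (hS : S.ShortExact) (P : C) :
    Nonempty (TriangularMatrix (End S.X₃) (Abelian.Ext S.X₃ P 1) (End P) ≃ₐ[k]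
      End (Q.obj (twoTerm (biprod.desc S.f (0 : P ⟶ S.X₂))))) :=
  nonempty_end_equiv_triangular (derivedBicone hS P) (derivedBicone_total hS P)
    (hom_shift_eq_zero P S.X₃) (endAlgEquiv k (singleFunctor C 0) S.X₃)
    (endAlgEquiv k (singleFunctor C 0 ⋙ shiftFunctor _ ((1 : ℕ) : ℤ)) P)
    Abelian.Ext.homLinearEquiv
    (fun x m => by
      change ((Abelian.Ext.mk₀ x).comp m (zero_add 1)).hom = _
      rw [Abelian.Ext.comp_hom, Abelian.Ext.mk₀_hom, ShiftedHom.mk₀_comp]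
      rfl)
    (fun x m => by
      change (m.comp (Abelian.Ext.mk₀ x) (add_zero 1)).hom = _
      rw [Abelian.Ext.comp_hom, Abelian.Ext.mk₀_hom, ShiftedHom.comp_mk₀]
      rfl)

end Derived

end Silted

end

theorem proposition3p2 {k : Type v} [Field k] [IsAlgClosed k] {H : Type u} [Ring H] [Algebra k H]
    (T P : ModuleCat.{u} Hᵐᵒᵖ) {A : Type w} [Ring A] [Algebra k A]
    (hA : Silted.IsSiltedWithRespectTo k T P A) :
    Silted.IsTiltedAlgebra k (End T) ∧
    Silted.IsHereditaryAlgebra k (End P) ∧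
    Nonempty (A ≃ₐ[k] Silted.TriangularMatrix (End T) (Abelian.Ext T P 1) (End P)) ∧
    ∃ (e : H) (he : IsIdempotentElem e),
      Nonempty (Silted.rightIdeal e ≃ₗ[Hᵐᵒᵖ] P) ∧
      Nonempty (End P ≃ₐ[k] he.Corner) ∧
      Silted.IsHereditaryAlgebra k (Silted.QuotientByIdempotent e) ∧
      ∃ T' : ModuleCat.{u} (Silted.QuotientByIdempotent e)ᵐᵒᵖ,
        Nonempty (Silted.inflate e T' ≅ T) ∧
        Silted.IsTilting (Silted.QuotientByIdempotent e) T' := by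
  obtain ⟨hH, hTP, hT, hP, X, -, ⟨Q₁, Q₀, f, p, hfp, ⟨e⟩⟩, ⟨φ⟩⟩ := hA
  have := hTP.finite_right
  have := hTP.projective_right
  obtain ⟨h₁, h₂⟩ := Silted.exists_idempotent_isTilting hH hTP hT hP
  refine ⟨h₁, hH.end P, ?_, h₂⟩
  let := HasDerivedCategory.standard (ModuleCat.{u} Hᵐᵒᵖ)
  obtain ⟨ψ⟩ := Silted.nonempty_end_equiv_triangular_ext k (hfp.shortExact hH) P
  -- The correspondence of `X` with `(T, P)` is an isomorphism in the homotopy category, which is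
  -- carried to the derived category by `DerivedCategory.Qh`.
  let i := (DerivedCategory.quotientCompQhIso (ModuleCat.{u} Hᵐᵒᵖ))
  let e' : DerivedCategory.Q.obj X ≅ DerivedCategory.Q.obj (Silted.twoTermComplex f P) :=
    (i.app X).symm ≪≫ DerivedCategory.Qh.mapIso e ≪≫ i.app _
  exact ⟨φ.trans ((Silted.endAlgEquivOfIso k e').trans ψ.symm)⟩
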